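/- **Setting.** Let $n,\tau_0\ge 1$ be integers with $n-\tau_0>4$. A *membership matrix* $M_\tau$ (for $1\le\tau\le n$) is an $n\times\tau$ matrix with entries in $\{0,1\}$, exactly one $1$ in each row and no zero column; $\mathcal I_k$ is the set of rows assigned to column $k$, $n_k=|\mathcal I_k|$, and $H_\tau=M_\tau(M_\tau^\top M_\tau)^{-1}M_\tau^\top$. Let $$Y=M_0\mu_0+\mathrm{diag}(M_0\sigma_0)\,U,\qquad U\sim N(0,I_n),$$ where $M_0$ is an $n\times\tau_0$ membership matrix all of whose components have $n_k\ge 2$ observations, $\mu_0\in\mathbb R^{\tau_0}$, and $\sigma_0\in(0,\infty)^{\tau_0}$ has smallest and largest entries $\sigma_{\min}$ and $\sigma_{\max}$. Assume $$C_{\min}=\min\{\|(I-H_\tau)M_0\mu_0\| : M_\tau \text{ a membership matrix},\ \tau<\tau_0\}>0,$$ with $C_{\min}=+\infty$ if $\tau_0=1$. **Candidate set.** Let $\mathcal V=\{u^s_1,\dots,u^s_N\}$, $N=|\mathcal V|$, consist of independent $N(0,I_n)$ vectors, independent of $U$. For $\lambda\in\mathbb R$ let $\widehat\Upsilon_{\mathcal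 V}(y)$ be the set of all pairs $(\tau,M_\tau)$ that, for at least one $u^s\in\mathcal V$, minimize $$\inf_{\mu\in\mathbb R^\tau,\ \sigma\in(0,\infty)^\tau}\Big\{n\log\Big(\frac{\|y-M_\tau\mu-\mathrm{diag}(M_\tau\sigma)u^s\|^2+1}{n}\Big)+2\lambda\tau\log n\Big\}$$ over all $\tau$ and all $n\times\tau$ membership matrices. **Confidence set.** Let $\hat\tau:\mathbb R^n\to\mathbb N$ be either an arbitrary measurable estimator or the BIC-based one, that is, the (smallest) minimizer over $\tau$ of $$\min_{M_\tau}\Big\{2\sum_k n_k\log\|\{(I-H_\tau)y\}_{\mathcal I_k}\|-\sum_k n_k\log n_k+2\tau\log n\Big\},$$ the minimum being over membership matrices with all $n_k\ge 2$. For given $(\tau,M_\tau)$ put $a(y)=(M_\tau^\top M_\tau)^{-1}M_\tau^\top y$, $b(y)_k=\|\{(I-H_\tau)y\}_{\mathcal I_k}\|$, and let $c(u)$ be the vector $(I-H_\tau)u$ with each block $\mathcal I_k$ divided by its norm (a zero block, which occurs for $n_k=1$, is left as $0$). With $U'\sim N(0,I_n)$ and $Y'=M_\tau a(y)+\mathrm{diag}(M_\tau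 b(y))c(U')$ let $P_{Y'}(t)=\mathbb P\{\hat\tau(Y')=t\}$ and $$\widetilde T(y,(\tau,M_\tau))=\sum_{t:\,P_{Y'}(t)>P_{Y'}(\hat\tau(y))}P_{Y'}(t),\qquad \Xi'_\alpha(y)=\Big\{\tau:\min_{M_\tau:\,(\tau,M_\tau)\in\widehat\Upsilon_{\mathcal V}(y)}\widetilde T(y,(\tau,M_\tau))\le\alpha\Big\}.$$ **Theorem.** For every $\delta>0$ there are $\gamma_\delta>0$ and $c>0$ such that $$\Lambda_\delta=\Big[\frac{\gamma_\delta^{1.5}}{\log(n)/n},\ \frac{\log\{0.5\,C_{\min}^2\sigma_{\max}\gamma_\delta/\sigma_{\min}+1\}}{2\tau_0\log(n)/n}\Big]$$ (unbounded to the right if $\tau_0=1$) is an interval of positive width, and for every $\lambda\in\Lambda_\delta$: (a) $\mathbb P_{U|\mathcal V}\{(\tau_0,M_0)\in\widehat\Upsilon_{\mathcal V}(Y)\}\ge 1-\delta-o_p(e^{-c|\mathcal V|})$; (b) for every $0<\alpha<1$, $\mathbb P_{U|\mathcal V}\{\tau_0\in\Xi'_\alpha(Y)\}\ge\alpha-\delta-o_p(e^{-c|\mathcal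 V|})$. Here $\mathbb P_{U|\mathcal V}$ is the conditional probability given $\mathcal V$, and $o_p(e^{-c|\mathcal V|})$ is a function $\varepsilon_N(\mathcal V)$ such that $e^{cN}\varepsilon_N(\mathcal V)\to 0$ in probability (with respect to $\mathcal V$) as $N=|\mathcal V|\to\infty$, with $n$ and the parameters fixed. -/

import Mathlib

open MeasureTheory ProbabilityTheory Filter Topology

noncomputable section

namespace GaussMix

/-- The law `N(0, I_n)` on `ℝⁿ`. -/
def stdNormal (n : ℕ) : Measure (Fin n → ℝ) :=
  Measure.pi fun _ => gaussianReal 0 1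

/-- A membership assignment of `n` observations to `τ` components, every component being
non-empty.  It encodes the `n × τ` matrix `M` whose entry `(i, k)` is `1` if `label i = k` and `0`
otherwise, so `(M v) i = v (label i)` for `v : Fin τ → ℝ`. -/
structure Membership (n τ : ℕ) where
  label : Fin n → Fin τ
  surj : Function.Surjective label

namespace Membership

variable {n τ : ℕ}

/-- The index set of component `k`. -/
def block (M : Membership n τ) (k : Fin τ) : Finset (Fin n) :=
  Finset.univ.filter fun i => M.label i = k

/-- The number `n_k` of observations in component `k`. -/
def size (M : Membership n τ) (k : Fin τ) : ℕ := (M.block k).card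

/-- `a(y) = (Mᵀ M)⁻¹ Mᵀ y`, the vector of component averages. -/
def mean (M : Membership n τ) (y : Fin n → ℝ) (k : Fin τ) : ℝ :=
  (∑ i ∈ M.block k, y i) / M.size k

/-- `(I - H) y` with `H = M (Mᵀ M)⁻¹ Mᵀ`. -/
def resid (M : Membership n τ) (y : Fin n → ℝ) (i : Fin n) : ℝ :=
  y i - M.mean y (M.label i)

/-- `b(y)`, the Euclidean norms of the residual vector on each component. -/
def scale (M : Membership n τ) (y : Fin n → ℝ) (k : Fin τ) : ℝ :=
  Real.sqrt (∑ i ∈ M.block k, M.resid y i ^ 2)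

/-- `c(u)`, the residual vector normalized to length one on each component. -/
def direction (M : Membership n τ) (u : Fin n → ℝ) (i : Fin n) : ℝ :=
  M.resid u i / M.scale u (M.label i)

/-- The sample `M μ + diag(M σ) u`. -/
def sample (M : Membership n τ) (μ σ : Fin τ → ℝ) (u : Fin n → ℝ) (i : Fin n) : ℝ :=
  μ (M.label i) + σ (M.label i) * u i

/-- The conditional repro sample `M a(y) + diag(M b(y)) c(u')`. -/
def repro (M : Membership n τ) (y u' : Fin n → ℝ) : Fin n → ℝ :=
  M.sample (M.mean y) (M.scale y) (M.direction u')

end Membership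

/-! ### Candidate set -/

/-- The modified BIC of `(τ, M)` at the data `y` and the artificial noise `u`: the infimum of
`n log ((‖y - M μ - diag(M σ) u‖² + 1) / n) + 2 lam τ log n`
over all `μ ∈ ℝ^τ` and `σ ∈ (0, ∞)^τ`. -/
def modifiedBIC {n τ : ℕ} (lam : ℝ) (y u : Fin n → ℝ) (M : Membership n τ) : ℝ :=
  ⨅ p : (Fin τ → ℝ) × (Fin τ → Set.Ioi (0 : ℝ)),
    ((n : ℝ) * Real.log
        ((∑ i, (y i - M.sample p.1 (fun k => (p.2 k : ℝ)) u i) ^ 2 + 1) / n)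
      + 2 * lam * τ * Real.log n)

/-- The candidate set: all pairs `(τ, M)` that minimize the modified BIC for one of the artificial
noise vectors `V 0, …, V (N - 1)`. -/
def candidateSet {n N : ℕ} (lam : ℝ) (V : Fin N → Fin n → ℝ) (y : Fin n → ℝ) :
    Set (Σ τ : ℕ, Membership n τ) :=
  {p | ∃ s : Fin N, ∀ q : Σ τ : ℕ, Membership n τ,
    modifiedBIC lam y (V s) p.2 ≤ modifiedBIC lam y (V s) q.2}

/-! ### Confidence set for the number of components -/

/-- The probability that the estimate of the number of components computed from the conditional
repro sample equals `t`. -/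
def reproProb {n τ : ℕ} (tauHat : (Fin n → ℝ) → ℕ) (M : Membership n τ) (y : Fin n → ℝ)
    (t : ℕ) : ℝ :=
  (stdNormal n).real {u' | tauHat (M.repro y u') = t}

/-- The nuclear statistic: the total probability of the values of the estimator that are more
likely than the one observed at `y`. -/
def nuclear {n τ : ℕ} (tauHat : (Fin n → ℝ) → ℕ) (M : Membership n τ) (y : Fin n → ℝ) : ℝ :=
  ∑' t : ℕ, {t | reproProb tauHat M y (tauHat y) < reproProb tauHat M y t}.indicator
    (reproProb tauHat M y) t

/-- The confidence set for the number of components, searched over the candidate set: the minimum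
of the nuclear statistic over the candidates with `τ` components (which are finitely many) is at
most `α`. -/
def confidenceSet {n N : ℕ} (tauHat : (Fin n → ℝ) → ℕ) (lam α : ℝ) (V : Fin N → Fin n → ℝ)
    (y : Fin n → ℝ) : Set ℕ :=
  {τ | ∃ M : Membership n τ, ⟨τ, M⟩ ∈ candidateSet lam V y ∧ nuclear tauHat M y ≤ α}

/-- `-2` times the maximal log-likelihood given `(τ, M)`, up to a constant, plus `2 τ log n`. -/
def bic {n τ : ℕ} (M : Membership n τ) (y : Fin n → ℝ) : ℝ :=
  2 * ∑ k, (M.size k : ℝ) * Real.log (M.scale y k)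
    - ∑ k, (M.size k : ℝ) * Real.log (M.size k) + 2 * τ * Real.log n

/-- The BIC-based estimator of the number of components (the smallest one in case of a tie).  The
likelihood is unbounded at an assignment with a one-element component, so that components have at
least two elements here. -/
def bicEstimator {n : ℕ} (y : Fin n → ℝ) : ℕ :=
  sInf {τ | ∃ M : Membership n τ, (∀ k, 2 ≤ M.size k) ∧
    ∀ (τ' : ℕ) (M' : Membership n τ'), (∀ k, 2 ≤ M'.size k) → bic M y ≤ bic M' y}

/-! ### Separation constant and penalty range -/

/-- `C_min`, the minimum of `‖(I - H_M) M₀ μ₀‖` over all assignments `M` to fewer than `τ₀`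
components.  It is used for `1 < τ₀` only, where there are such assignments. -/
def cMin {n τ₀ : ℕ} (M₀ : Membership n τ₀) (μ₀ : Fin τ₀ → ℝ) : ℝ :=
  ⨅ p : {p : Σ τ : ℕ, Membership n τ // p.1 < τ₀},
    Real.sqrt (∑ i, p.1.2.resid (fun j => μ₀ (M₀.label j)) i ^ 2)

/-- Lower end point of the range of the penalty parameter. -/
def lamLower (n : ℕ) (γ : ℝ) : ℝ := γ ^ (1.5 : ℝ) / (Real.log n / n)

/-- Upper end point of the range of the penalty parameter, for `1 < τ₀`. -/
def lamUpper {n τ₀ : ℕ} (M₀ : Membership n τ₀) (μ₀ σ₀ : Fin τ₀ → ℝ) (γ : ℝ) : ℝ :=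
  Real.log (0.5 * cMin M₀ μ₀ ^ 2 * (⨆ k, σ₀ k) * γ / (⨅ k, σ₀ k) + 1)
    / (2 * τ₀ * Real.log n / n)

/-- The range of the penalty parameter.  For `τ₀ = 1` the minimum defining `C_min` is over the
empty set, hence `+∞`, and the range is unbounded above. -/
def lamRange {n τ₀ : ℕ} (M₀ : Membership n τ₀) (μ₀ σ₀ : Fin τ₀ → ℝ) (γ : ℝ) : Set ℝ :=
  {lam | lamLower n γ ≤ lam ∧ (1 < τ₀ → lam ≤ lamUpper M₀ μ₀ σ₀ γ)}

/-! ### Asymptotics in the Monte-Carlo size -/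

/-- `ε = o_p(e^{-c N})` when the Monte-Carlo set `V` consists of `N` independent draws from
`N(0, I_n)`: `e^{c N} ε_N(V)` tends to `0` in probability. -/
def IsLittleOpExp {n : ℕ} (c : ℝ) (ε : (N : ℕ) → (Fin N → Fin n → ℝ) → ℝ) : Prop :=
  ∀ η : ℝ, 0 < η → Tendsto
    (fun N : ℕ => (Measure.pi fun _ : Fin N => stdNormal n)
      {V | η ≤ |Real.exp (c * N) * ε N V|}) atTop (𝓝 0)

/-- `P_N(V) ≥ level - o_p(e^{-c N})`. -/
def AtLeastUpToExp {n : ℕ} (c level : ℝ) (P : (N : ℕ) → (Fin N → Fin n → ℝ) → ℝ) : Prop :=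
  ∃ ε : (N : ℕ) → (Fin N → Fin n → ℝ) → ℝ,
    IsLittleOpExp c ε ∧ ∀ N V, level - ε N V ≤ P N V

/-- The conditional probability, given the Monte-Carlo set `V`, that the candidate set computed
from `Y = M₀ μ₀ + diag(M₀ σ₀) U` contains `(τ₀, M₀)`; here `U ~ N(0, I_n)` is independent of `V`. -/
def candidateProb {n τ₀ : ℕ} (M₀ : Membership n τ₀) (μ₀ σ₀ : Fin τ₀ → ℝ) (lam : ℝ)
    (N : ℕ) (V : Fin N → Fin n → ℝ) : ℝ :=
  (stdNormal n).real {U | ⟨τ₀, M₀⟩ ∈ candidateSet lam V (M₀.sample μ₀ σ₀ U)}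

/-- The conditional probability, given the Monte-Carlo set `V`, that the confidence set computed
from `Y = M₀ μ₀ + diag(M₀ σ₀) U` contains `τ₀`; here `U ~ N(0, I_n)` is independent of `V`. -/
def coverageProb {n τ₀ : ℕ} (tauHat : (Fin n → ℝ) → ℕ) (M₀ : Membership n τ₀)
    (μ₀ σ₀ : Fin τ₀ → ℝ) (lam α : ℝ) (N : ℕ) (V : Fin N → Fin n → ℝ) : ℝ :=
  (stdNormal n).real {U | τ₀ ∈ confidenceSet tauHat lam α V (M₀.sample μ₀ σ₀ U)}

end GaussMix

end

open GaussMix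

/-! The proof joins a deterministic optimality statement, a Monte-Carlo estimate and an independence
argument.

Deterministic part: if the artificial noise `u` is close enough to the true noise `U`, then `M₀`
minimizes the criterion (`modifiedBIC_le_of_closeNoise`). At the true parameters the residual sum of
squares is below `γ ^ 1.5`. Within one component, fitted values lie on a line over `u`, so a
component containing three observations that mix true components leaves a residual bounded below by
a triangle determinant; the upper end of the penalty range prevents any saving in components from
paying for it. An assignment without such a triple has at least `τ₀` components by a weight count.
If it has more, the lower end of the range rules it out; if it has exactly `τ₀`, it cannot fit
better than `M₀`.

Probabilistic part: `0 < cMin` makes the means distinct, so almost surely no mixed triple is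
collinear, and `(U, U)` lies in `closeNoise` with probability above `1 - δ` once `γ` is small. The
relation is open, so a single draw then succeeds with positive probability. Where this probability
is at least `p`, all `N` draws miss with probability at most `(1 - p) ^ N`, and Markov's inequality
gives (a).

Coverage: residual directions are independent of component means and residual norms, and the true
noise reproduces the data (`repro_self`). Given those statistics, the observed estimate therefore
has the law of its repro copy, and a level-set inequality for laws on `ℕ` gives coverage `α` at
`M₀`. A union bound with (a) gives (b). -/

namespace GaussMix

/-! ### Collinearity of observation–noise pairs -/

/-- Twice the signed area of the triangle with vertices `(u i, y i)`, `(u j, y j)`, `(u k, y k)`. -/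
def triDet {n : ℕ} (y u : Fin n → ℝ) (i j k : Fin n) : ℝ :=
  y i * (u j - u k) + y j * (u k - u i) + y k * (u i - u j)

/-- The sum of the squared differences of three noise coordinates. -/
def triSpread {n : ℕ} (u : Fin n → ℝ) (i j k : Fin n) : ℝ :=
  (u j - u k) ^ 2 + (u k - u i) ^ 2 + (u i - u j) ^ 2

/-- The residual sum of squares of `y` at the parameters `μ`, `σ` and the noise `u`. -/
def rss {n τ : ℕ} (M : Membership n τ) (y u : Fin n → ℝ) (μ σ : Fin τ → ℝ) : ℝ :=
  ∑ i, (y i - M.sample μ σ u i) ^ 2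

lemma rss_nonneg {n τ : ℕ} (M : Membership n τ) (y u : Fin n → ℝ) (μ σ : Fin τ → ℝ) :
    0 ≤ rss M y u μ σ :=
  Finset.sum_nonneg fun _ _ => sq_nonneg _

lemma triSpread_nonneg {n : ℕ} (u : Fin n → ℝ) (i j k : Fin n) : 0 ≤ triSpread u i j k := by
  unfold triSpread; positivity

/-- The determinant annihilates affine functions of `u`, so on a common component only the residuals
contribute; Cauchy–Schwarz bounds the rest. -/
lemma triDet_sq_le {n τ : ℕ} (M : Membership n τ) (y u : Fin n → ℝ) (μ σ : Fin τ → ℝ)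
    {i j k : Fin n} (hij : i ≠ j) (hik : i ≠ k) (hjk : j ≠ k)
    (h₁ : M.label i = M.label j) (h₂ : M.label i = M.label k) :
    triDet y u i j k ^ 2 ≤ triSpread u i j k * rss M y u μ σ := by
  set e : Fin n → ℝ := fun i => y i - M.sample μ σ u i with he
  have hD : triDet y u i j k = e i * (u j - u k) + e j * (u k - u i) + e k * (u i - u j) := by
    simp only [he, triDet, Membership.sample, ← h₁, ← h₂]; ring
  have hS : e i ^ 2 + e j ^ 2 + e k ^ 2 ≤ rss M y u μ σ := by
    have : ∑ l ∈ {i, j, k}, e l ^ 2 ≤ rss M y u μ σ :=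
      Finset.sum_le_sum_of_subset_of_nonneg (Finset.subset_univ _) fun _ _ _ => sq_nonneg _
    rw [Finset.sum_insert (by simp [hij, hik]), Finset.sum_pair hjk] at this
    linarith
  refine le_trans ?_ (mul_le_mul_of_nonneg_left hS (triSpread_nonneg u i j k))
  rw [hD, triSpread]
  nlinarith [sq_nonneg (e i * (u k - u i) - e j * (u j - u k)),
    sq_nonneg (e i * (u i - u j) - e k * (u j - u k)),
    sq_nonneg (e j * (u i - u j) - e k * (u k - u i))]

lemma le_rss_of_triDet {n τ : ℕ} (M : Membership n τ) (y u : Fin n → ℝ) (μ σ : Fin τ → ℝ)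
    {i j k : Fin n} (hij : i ≠ j) (hik : i ≠ k) (hjk : j ≠ k)
    (h₁ : M.label i = M.label j) (h₂ : M.label i = M.label k) {η : ℝ}
    (h : η * triSpread u i j k < triDet y u i j k ^ 2) : η ≤ rss M y u μ σ := by
  have h' := h.trans_le (triDet_sq_le M y u μ σ hij hik hjk h₁ h₂)
  by_contra! hlt
  nlinarith [triSpread_nonneg u i j k]

/-! ### Comparing the number of blocks of two partitions -/

/-- Giving each observation the inverse size of its component makes every component weigh one; this
lets two partitions be compared block by block. -/
lemma Membership.sum_inv_size {n τ : ℕ} (M : Membership n τ) :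
    ∑ i, (1 : ℝ) / M.size (M.label i) = τ := by
  have h : ∀ k, ∑ i ∈ M.block k, (1 : ℝ) / M.size (M.label i) = 1 := by
    intro k
    have hpos : 0 < M.size k := by
      obtain ⟨i, hi⟩ := M.surj k
      exact Finset.card_pos.2 ⟨i, by simp [Membership.block, hi]⟩
    rw [Finset.sum_congr rfl (g := fun _ => (1 : ℝ) / M.size k)]
    · rw [Finset.sum_const, nsmul_eq_mul, ← Membership.size]
      field_simp
    · intro i hi
      rw [(Finset.mem_filter.1 hi).2]
  rw [← Finset.sum_fiberwise (s := Finset.univ) (g := M.label)]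
  calc _ = ∑ k : Fin τ, (1 : ℝ) := Finset.sum_congr rfl fun k _ => h k
    _ = τ := by simp

lemma Membership.size_pos {n τ : ℕ} (M : Membership n τ) (i : Fin n) :
    0 < M.size (M.label i) :=
  Finset.card_pos.2 ⟨i, by simp [Membership.block]⟩

/-- If each triple of distinct observations sharing a component in `M` shares one in `M₀`, then
the components of `M` carry at least total weight one on each component of `M₀`. -/
lemma Membership.one_le_weight {n τ τ₀ : ℕ} (M₀ : Membership n τ₀) (M : Membership n τ)
    (hM₀ : ∀ k, 2 ≤ M₀.size k)
    (h : ∀ i j l : Fin n, i ≠ j → i ≠ l → j ≠ l → M.label i = M.label j →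
      M.label i = M.label l → M₀.label i = M₀.label j) (k : Fin τ₀) :
    1 ≤ ∑ i ∈ M₀.block k, (1 : ℝ) / M.size (M.label i) ∧
    (∑ i ∈ M₀.block k, (1 : ℝ) / M.size (M.label i) ≤ 1 → 3 ≤ M₀.size k →
      ∀ i ∈ M₀.block k, ∀ j ∈ M₀.block k, M.label i = M.label j) := by
  have hnn : ∀ i, (0 : ℝ) < 1 / M.size (M.label i) := fun i => by
    have := M.size_pos i; positivity
  -- A component of `M` inside the block already contributes weight one, and equality forces it to
  -- fill the block.
  by_cases hin : ∃ i ∈ M₀.block k, M.block (M.label i) ⊆ M₀.block k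
  · obtain ⟨i, hi, hsub⟩ := hin
    have h1 : ∑ j ∈ M.block (M.label i), (1 : ℝ) / M.size (M.label j) = 1 := by
      rw [Finset.sum_congr rfl (g := fun _ => (1 : ℝ) / M.size (M.label i))]
      · rw [Finset.sum_const, nsmul_eq_mul, ← Membership.size]
        have := M.size_pos i
        field_simp
      · intro j hj
        rw [(Finset.mem_filter.1 hj).2]
    have hsplit := Finset.sum_sdiff hsub (f := fun j => (1 : ℝ) / M.size (M.label j))
    rw [h1] at hsplit
    refine ⟨?_, fun hle _ => ?_⟩
    · rw [← hsplit]
      have := Finset.sum_nonneg (s := M₀.block k \ M.block (M.label i))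
        fun j _ => (hnn j).le
      linarith
    · have key : ∀ j ∈ M₀.block k, M.label j = M.label i := by
        intro j hj
        by_contra hne
        have : (0 : ℝ) < ∑ j ∈ M₀.block k \ M.block (M.label i),
            (1 : ℝ) / M.size (M.label j) :=
          Finset.sum_pos (fun j _ => hnn j)
            ⟨j, by simp [Membership.block, hne, (Finset.mem_filter.1 hj).2]⟩
        linarith
      intro a ha b hb
      rw [key a ha, key b hb]
  · push Not at hin
    -- Otherwise each component of `M` meeting the block has at most two elements, since a third
    -- would force it into the block. Every weight is then at least one half.
    have h2 : ∀ i ∈ M₀.block k, (1 : ℝ) / 2 ≤ 1 / M.size (M.label i) := by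
      intro i hi
      have hle : M.size (M.label i) ≤ 2 := by
        by_contra! hlt
        refine hin i hi fun j hj => ?_
        by_cases hij : i = j
        · exact hij ▸ hi
        have : ∃ l ∈ M.block (M.label i), l ∉ ({i, j} : Finset (Fin n)) :=
          Finset.exists_mem_notMem_of_card_lt_card
            (lt_of_le_of_lt Finset.card_le_two hlt)
        obtain ⟨l, hl, hl'⟩ := this
        simp only [Finset.mem_insert, Finset.mem_singleton, not_or] at hl'
        simp only [Membership.block, Finset.mem_filter, Finset.mem_univ, true_and] at hi hj hl ⊢
        rw [← h i j l hij (Ne.symm hl'.1) (Ne.symm hl'.2) hj.symm hl.symm, hi]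
      have := M.size_pos i
      gcongr
      exact_mod_cast hle
    have h3 : (M₀.size k : ℝ) / 2 ≤ ∑ i ∈ M₀.block k, (1 : ℝ) / M.size (M.label i) := by
      have := Finset.card_nsmul_le_sum _ _ _ h2
      rw [nsmul_eq_mul, ← Membership.size] at this
      linarith
    have h4 : (2 : ℝ) ≤ M₀.size k := by exact_mod_cast hM₀ k
    refine ⟨by linarith, fun hle h3' => ?_⟩
    have h5 : (3 : ℝ) ≤ M₀.size k := by exact_mod_cast h3'
    linarith

lemma Membership.components_le {n τ τ₀ : ℕ} (M₀ : Membership n τ₀) (M : Membership n τ)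
    (hM₀ : ∀ k, 2 ≤ M₀.size k)
    (h : ∀ i j l : Fin n, i ≠ j → i ≠ l → j ≠ l → M.label i = M.label j →
      M.label i = M.label l → M₀.label i = M₀.label j) :
    τ₀ ≤ τ ∧ (τ = τ₀ → ∀ k, 3 ≤ M₀.size k →
      ∀ i ∈ M₀.block k, ∀ j ∈ M₀.block k, M.label i = M.label j) := by
  have hw := M₀.one_le_weight M hM₀ h
  have hsum : ∑ k, ∑ i ∈ M₀.block k, (1 : ℝ) / M.size (M.label i) = τ := by
    rw [← M.sum_inv_size, ← Finset.sum_fiberwise (s := Finset.univ) (g := M₀.label)]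
    rfl
  have hle : (τ₀ : ℝ) ≤ τ := by
    rw [← hsum]
    calc (τ₀ : ℝ) = ∑ _k : Fin τ₀, (1 : ℝ) := by simp
      _ ≤ _ := Finset.sum_le_sum fun k _ => (hw k).1
  refine ⟨by exact_mod_cast hle, fun heq k => (hw k).2 ?_⟩
  have h1 : ∑ k, (∑ i ∈ M₀.block k, (1 : ℝ) / M.size (M.label i) - 1) = 0 := by
    rw [Finset.sum_sub_distrib, hsum, heq]; simp
  have := (Finset.sum_eq_zero_iff_of_nonneg fun k _ => sub_nonneg.2 (hw k).1).1 h1 k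
    (Finset.mem_univ k)
  linarith

/-! ### Optimality of the true assignment when the artificial noise is close to the true one -/

/-- The coefficient of `γ` in the upper end point of the penalty range. -/
noncomputable def sepConst {n τ₀ : ℕ} (M₀ : Membership n τ₀) (μ₀ σ₀ : Fin τ₀ → ℝ) : ℝ :=
  0.5 * cMin M₀ μ₀ ^ 2 * (⨆ k, σ₀ k) / (⨅ k, σ₀ k)

/-- A residual sum of squares that no admissible penalty can compensate. -/
noncomputable def fitGap (κ γ : ℝ) : ℝ := (1 + κ * γ) * (1 + γ ^ (1.5 : ℝ)) - 1

/-- Pairs of a true noise vector and an artificial noise vector for which the true assignment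
minimizes the modified criterion. -/
def closeNoise {n τ₀ : ℕ} (M₀ : Membership n τ₀) (μ₀ σ₀ : Fin τ₀ → ℝ) (γ : ℝ) :
    Set ((Fin n → ℝ) × (Fin n → ℝ)) :=
  {p | (∀ i j k : Fin n, i ≠ j → i ≠ k → j ≠ k → M₀.label i ≠ M₀.label j →
      fitGap (sepConst M₀ μ₀ σ₀) γ * triSpread p.2 i j k <
        triDet (M₀.sample μ₀ σ₀ p.1) p.2 i j k ^ 2) ∧
    ∑ i, (σ₀ (M₀.label i) * (p.1 i - p.2 i)) ^ 2 < γ ^ (1.5 : ℝ) ∧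
    ∀ i j : Fin n, i ≠ j → 0 < (p.2 i - p.2 j) * (p.1 i - p.1 j)}

lemma sepConst_nonneg {n τ₀ : ℕ} (M₀ : Membership n τ₀) (μ₀ σ₀ : Fin τ₀ → ℝ)
    (hσ₀ : ∀ k, 0 < σ₀ k) : 0 ≤ sepConst M₀ μ₀ σ₀ := by
  have h1 : 0 ≤ ⨆ k, σ₀ k := Real.iSup_nonneg fun k => (hσ₀ k).le
  have h2 : 0 ≤ ⨅ k, σ₀ k := Real.iInf_nonneg fun k => (hσ₀ k).le
  unfold sepConst; positivity

lemma lamUpper_eq {n τ₀ : ℕ} (M₀ : Membership n τ₀) (μ₀ σ₀ : Fin τ₀ → ℝ) (γ : ℝ) :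
    lamUpper M₀ μ₀ σ₀ γ =
      Real.log (1 + sepConst M₀ μ₀ σ₀ * γ) / (2 * τ₀ * Real.log n / n) := by
  unfold lamUpper sepConst
  congr 2
  ring

lemma modifiedBIC_le {n τ τ' : ℕ} (hn : 0 < n) (lam : ℝ) (y u : Fin n → ℝ) (M : Membership n τ)
    (M' : Membership n τ')
    (h : ∀ μ σ : Fin τ' → ℝ, (∀ k, 0 < σ k) → ∃ μ₁ σ₁ : Fin τ → ℝ, (∀ k, 0 < σ₁ k) ∧
      n * Real.log (1 + rss M y u μ₁ σ₁) + 2 * lam * τ * Real.log n ≤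
      n * Real.log (1 + rss M' y u μ σ) + 2 * lam * τ' * Real.log n) :
    modifiedBIC lam y u M ≤ modifiedBIC lam y u M' := by
  have hn' : (0 : ℝ) < n := by exact_mod_cast hn
  have hlog : ∀ r : ℝ, 0 ≤ r → Real.log ((r + 1) / n) = Real.log (1 + r) - Real.log n := by
    intro r hr
    rw [Real.log_div (by positivity) hn'.ne', add_comm]
  -- The `+ 1` inside the logarithm keeps the criterion bounded below, so the infimum is a genuine
  -- one.
  have hbdd : BddBelow (Set.range fun p : (Fin τ → ℝ) × (Fin τ → Set.Ioi (0 : ℝ)) =>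
      ((n : ℝ) * Real.log
        ((∑ i, (y i - M.sample p.1 (fun k => (p.2 k : ℝ)) u i) ^ 2 + 1) / n)
      + 2 * lam * τ * Real.log n)) := by
    refine ⟨n * (0 - Real.log n) + 2 * lam * τ * Real.log n, ?_⟩
    rintro _ ⟨p, rfl⟩
    have h0 := rss_nonneg M y u p.1 (fun k => (p.2 k : ℝ))
    have : 0 ≤ Real.log (1 + rss M y u p.1 (fun k => (p.2 k : ℝ))) :=
      Real.log_nonneg (by linarith)
    have e := hlog _ h0
    unfold rss at e this
    dsimp only
    rw [e]
    gcongr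
  have : Nonempty ((Fin τ' → ℝ) × (Fin τ' → Set.Ioi (0 : ℝ))) :=
    ⟨(0, fun _ => ⟨1, by simp⟩)⟩
  refine le_ciInf fun p => ?_
  obtain ⟨μ₁, σ₁, hσ₁, hle⟩ :=
    h p.1 (fun k => (p.2 k : ℝ)) fun k => (p.2 k).2
  refine (ciInf_le hbdd (μ₁, fun k => ⟨σ₁ k, hσ₁ k⟩)).trans ?_
  have e1 := hlog _ (rss_nonneg M y u μ₁ σ₁)
  have e2 := hlog _ (rss_nonneg M' y u p.1 (fun k => (p.2 k : ℝ)))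
  unfold rss at e1 e2 hle
  dsimp only
  rw [e1, e2]
  linarith

/-- A component with two observations is fitted exactly, with a positive slope if the noise and
the observations are ordered in the same way. -/
lemma exists_fit_of_size_two {n τ₀ : ℕ} (M₀ : Membership n τ₀) (y u : Fin n → ℝ) (k : Fin τ₀)
    (hk : M₀.size k = 2)
    (h : ∀ i ∈ M₀.block k, ∀ j ∈ M₀.block k, i ≠ j → 0 < (u i - u j) * (y i - y j)) :
    ∃ m s : ℝ, 0 < s ∧ ∀ i ∈ M₀.block k, y i = m + s * u i := by
  obtain ⟨a, b, hab, hblk⟩ := Finset.card_eq_two.1 hk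
  have ha : a ∈ M₀.block k := by simp [hblk]
  have hb : b ∈ M₀.block k := by simp [hblk]
  have hpos := h a ha b hb hab
  have hne : u a - u b ≠ 0 := fun h0 => by simp [h0] at hpos
  refine ⟨y a - (y a - y b) / (u a - u b) * u a, (y a - y b) / (u a - u b), ?_, ?_⟩
  · have : (y a - y b) / (u a - u b) = (u a - u b) * (y a - y b) / (u a - u b) ^ 2 := by
      field_simp
    rw [this]
    positivity
  · intro i hi
    rw [hblk, Finset.mem_insert, Finset.mem_singleton] at hi
    rcases hi with rfl | rfl
    · ring
    · field_simp; ring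

/-- A block of size at least three inherits the parameters of the single component of `M` covering
it. A block of size two may be split by `M`, but is fitted exactly. -/
lemma exists_rss_le {n τ₀ : ℕ} (M₀ M : Membership n τ₀) (y u : Fin n → ℝ)
    (hM₀ : ∀ k, 2 ≤ M₀.size k)
    (hblk : ∀ k, 3 ≤ M₀.size k → ∀ i ∈ M₀.block k, ∀ j ∈ M₀.block k, M.label i = M.label j)
    (hord : ∀ i j, i ≠ j → M₀.label i = M₀.label j → 0 < (u i - u j) * (y i - y j))
    (μ σ : Fin τ₀ → ℝ) (hσ : ∀ k, 0 < σ k) :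
    ∃ μ₁ σ₁ : Fin τ₀ → ℝ, (∀ k, 0 < σ₁ k) ∧ rss M₀ y u μ₁ σ₁ ≤ rss M y u μ σ := by
  have key : ∀ k, ∃ m s : ℝ, 0 < s ∧ ∀ i ∈ M₀.block k,
      (y i - (m + s * u i)) ^ 2 ≤ (y i - M.sample μ σ u i) ^ 2 := by
    intro k
    rcases (hM₀ k).eq_or_lt with h2 | h3
    · obtain ⟨m, s, hs, hfit⟩ := exists_fit_of_size_two M₀ y u k h2.symm fun i hi j hj hij =>
        hord i j hij (by rw [(Finset.mem_filter.1 hi).2, (Finset.mem_filter.1 hj).2])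
      refine ⟨m, s, hs, fun i hi => ?_⟩
      rw [← hfit i hi]
      simpa using sq_nonneg _
    · obtain ⟨a, ha⟩ := M₀.surj k
      have ha' : a ∈ M₀.block k := by simp [Membership.block, ha]
      refine ⟨μ (M.label a), σ (M.label a), hσ _, fun i hi => ?_⟩
      rw [Membership.sample, hblk k h3 i hi a ha']
  choose m s hs hle using key
  refine ⟨m, s, hs, Finset.sum_le_sum fun i _ => ?_⟩
  exact hle (M₀.label i) i (by simp [Membership.block])

lemma modifiedBIC_le_of_closeNoise {n τ₀ : ℕ} (hn : 1 < n) (M₀ : Membership n τ₀)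
    (hM₀ : ∀ k, 2 ≤ M₀.size k) (μ₀ σ₀ : Fin τ₀ → ℝ) (hσ₀ : ∀ k, 0 < σ₀ k)
    {γ : ℝ} (hγ : 0 < γ) {U u : Fin n → ℝ} (h : (U, u) ∈ closeNoise M₀ μ₀ σ₀ γ)
    {lam : ℝ} (hlam : lam ∈ lamRange M₀ μ₀ σ₀ γ) {τ : ℕ} (M : Membership n τ) :
    modifiedBIC lam (M₀.sample μ₀ σ₀ U) u M₀ ≤ modifiedBIC lam (M₀.sample μ₀ σ₀ U) u M := by
  obtain ⟨htri, hdist, hord⟩ := h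
  obtain ⟨hlow, hup⟩ := hlam
  dsimp only at htri hdist hord
  set y := M₀.sample μ₀ σ₀ U with hy
  set κ := sepConst M₀ μ₀ σ₀ with hκ
  have hκ0 : 0 ≤ κ := sepConst_nonneg M₀ μ₀ σ₀ hσ₀
  have hn' : (0 : ℝ) < n := by exact_mod_cast (by omega : 0 < n)
  have hlogn : 0 < Real.log n := Real.log_pos (by exact_mod_cast hn)
  have hγ' : 0 < γ ^ (1.5 : ℝ) := Real.rpow_pos_of_pos hγ _
  have hlow' : n * γ ^ (1.5 : ℝ) ≤ lam * Real.log n := by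
    rw [lamLower, div_le_iff₀ (by positivity)] at hlow
    calc n * γ ^ (1.5 : ℝ) ≤ n * (lam * (Real.log n / n)) := by gcongr
      _ = lam * Real.log n := by field_simp
  have hlam0 : 0 < lam := by
    have : 0 < lam * Real.log n := lt_of_lt_of_le (by positivity) hlow'
    exact (pos_iff_pos_of_mul_pos this).2 hlogn
  have hrss0 : rss M₀ y u μ₀ σ₀ < γ ^ (1.5 : ℝ) := by
    refine lt_of_eq_of_lt (Finset.sum_congr rfl fun i _ => ?_) hdist
    simp only [hy, Membership.sample]; ring
  have hrss0' := rss_nonneg M₀ y u μ₀ σ₀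
  have hlog0 : Real.log (1 + rss M₀ y u μ₀ σ₀) ≤ γ ^ (1.5 : ℝ) := by
    have := Real.log_le_sub_one_of_pos (by linarith : 0 < 1 + rss M₀ y u μ₀ σ₀)
    linarith
  by_cases hbad : ∃ i j l : Fin n, i ≠ j ∧ i ≠ l ∧ j ≠ l ∧ M.label i = M.label j ∧
      M.label i = M.label l ∧ M₀.label i ≠ M₀.label j
  · obtain ⟨i, j, l, hij, hil, hjl, e1, e2, hne⟩ := hbad
    refine modifiedBIC_le (by omega) _ _ _ _ _ fun μ σ _ => ⟨μ₀, σ₀, hσ₀, ?_⟩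
    have hgap := le_rss_of_triDet M y u μ σ hij hil hjl e1 e2 (htri i j l hij hil hjl hne)
    have hκγ : 0 ≤ κ * γ := by positivity
    -- `fitGap` is chosen so that the excess of the logarithm is at least `log (1 + κ * γ)`, the
    -- largest penalty saving allowed by `lamUpper`.
    have h1 : (1 + κ * γ) * (1 + rss M₀ y u μ₀ σ₀) ≤ 1 + rss M y u μ σ := by
      unfold fitGap at hgap
      nlinarith
    have h2 : Real.log (1 + κ * γ) + Real.log (1 + rss M₀ y u μ₀ σ₀) ≤
        Real.log (1 + rss M y u μ σ) := by
      rw [← Real.log_mul (by positivity) (by positivity)]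
      exact Real.log_le_log (by positivity) h1
    have h2' : 0 ≤ Real.log (1 + κ * γ) := Real.log_nonneg (by linarith)
    rcases lt_or_ge τ τ₀ with hlt | hge
    · have hτ : 1 < τ₀ := by
        have : 0 < τ := (M.label i).pos
        omega
      have h3 := hup hτ
      have hτ' : (0 : ℝ) < τ₀ := by exact_mod_cast (by omega : 0 < τ₀)
      rw [lamUpper_eq, le_div_iff₀ (by positivity)] at h3
      have h4 : 2 * lam * τ₀ * Real.log n ≤ n * Real.log (1 + κ * γ) := by
        calc 2 * lam * τ₀ * Real.log n = n * (lam * (2 * τ₀ * Real.log n / n)) := by field_simp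
          _ ≤ _ := by gcongr
      have h5 : 0 ≤ 2 * lam * τ * Real.log n := by positivity
      have h6 := mul_le_mul_of_nonneg_left h2 hn'.le
      linarith
    · have h3 : 2 * lam * τ₀ * Real.log n ≤ 2 * lam * τ * Real.log n := by
        gcongr
      have h6 : (n : ℝ) * Real.log (1 + rss M₀ y u μ₀ σ₀) ≤
          n * Real.log (1 + rss M y u μ σ) := by
        gcongr
        nlinarith
      linarith
  · have hgood : ∀ i j l : Fin n, i ≠ j → i ≠ l → j ≠ l → M.label i = M.label j →
        M.label i = M.label l → M₀.label i = M₀.label j := by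
      intro i j l h1 h2 h3 h4 h5
      by_contra hne
      exact hbad ⟨i, j, l, h1, h2, h3, h4, h5, hne⟩
    obtain ⟨hle, heq⟩ := M₀.components_le M hM₀ hgood
    rcases hle.eq_or_lt with rfl | hlt
    · have key : ∀ i j, i ≠ j → M₀.label i = M₀.label j → 0 < (u i - u j) * (y i - y j) := by
        intro i j hij hl
        have : (u i - u j) * (y i - y j) =
            σ₀ (M₀.label j) * ((u i - u j) * (U i - U j)) := by
          simp only [hy, Membership.sample, hl]; ring
        rw [this]
        exact mul_pos (hσ₀ _) (hord i j hij)
      refine modifiedBIC_le (by omega) _ _ _ _ _ fun μ σ hσ => ?_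
      obtain ⟨μ₁, σ₁, hσ₁, hr⟩ := exists_rss_le M₀ M y u hM₀ (heq rfl) key μ σ hσ
      refine ⟨μ₁, σ₁, hσ₁, ?_⟩
      have := rss_nonneg M₀ y u μ₁ σ₁
      gcongr
    -- One extra component costs `2 * lam * log n`, at least twice the bound `n * γ ^ 1.5` on the
    -- whole misfit of `M₀`.
    · refine modifiedBIC_le (by omega) _ _ _ _ _ fun μ σ _ => ⟨μ₀, σ₀, hσ₀, ?_⟩
      have h1 : 0 ≤ Real.log (1 + rss M y u μ σ) :=
        Real.log_nonneg (by linarith [rss_nonneg M y u μ σ])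
      have h2 : (τ₀ : ℝ) + 1 ≤ τ := by exact_mod_cast hlt
      have h3 : 2 * lam * Real.log n * (τ₀ + 1) ≤ 2 * lam * Real.log n * τ := by gcongr
      have h4 : (n : ℝ) * Real.log (1 + rss M₀ y u μ₀ σ₀) ≤ n * γ ^ (1.5 : ℝ) := by gcongr
      have h5 : 0 ≤ (n : ℝ) * γ ^ (1.5 : ℝ) := by positivity
      have h6 := mul_nonneg hn'.le h1
      nlinarith

/-! ### Basic properties of the Gaussian law -/

instance (n : ℕ) : IsProbabilityMeasure (stdNormal n) := by
  unfold stdNormal; infer_instance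

instance (n : ℕ) : (stdNormal n).IsOpenPosMeasure := by
  have h : (gaussianReal 0 1).IsOpenPosMeasure :=
    (gaussianReal_absolutelyContinuous' 0 one_ne_zero).isOpenPosMeasure
  unfold stdNormal; infer_instance

/-- Both sides agree on boxes, where the integral of the product factorizes. It serves for absolute
continuity and later for exponential tilting. -/
lemma pi_withDensity_ofReal {ι : Type*} [Fintype ι] (μ : ι → Measure ℝ) [∀ i, SigmaFinite (μ i)]
    (f : ι → ℝ → ℝ) (hf : ∀ i, Integrable (f i) (μ i)) (h0 : ∀ i x, 0 ≤ f i x) :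
    (Measure.pi fun i => (μ i).withDensity fun x => ENNReal.ofReal (f i x)) =
      (Measure.pi μ).withDensity fun x => ENNReal.ofReal (∏ i, f i (x i)) := by
  have : ∀ i, SigmaFinite ((μ i).withDensity fun x => ENNReal.ofReal (f i x)) := fun i => by
    have := isFiniteMeasure_withDensity_ofReal (hf i).2
    infer_instance
  refine Measure.pi_eq fun s hs => ?_
  rw [withDensity_apply _ (MeasurableSet.univ_pi hs), Measure.restrict_pi_pi,
    ← ofReal_integral_eq_lintegral_ofReal
      (Integrable.fintype_prod_dep fun i => (hf i).mono_measure Measure.restrict_le_self)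
      (ae_of_all _ fun x => Finset.prod_nonneg fun i _ => h0 i _),
    integral_fintype_prod_eq_prod,
    ENNReal.ofReal_prod_of_nonneg fun i _ => integral_nonneg fun x => h0 i x]
  refine Finset.prod_congr rfl fun i _ => ?_
  rw [withDensity_apply _ (hs i),
    ofReal_integral_eq_lintegral_ofReal ((hf i).mono_measure Measure.restrict_le_self)
      (ae_of_all _ fun x => h0 i x)]

lemma stdNormal_absolutelyContinuous (n : ℕ) : stdNormal n ≪ volume := by
  have h : stdNormal n =
      (Measure.pi fun i : Fin n => (volume : Measure ℝ)).withDensity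
        fun x => ENNReal.ofReal (∏ i, gaussianPDFReal 0 1 (x i)) := by
    rw [← pi_withDensity_ofReal (fun _ => volume) (fun _ => gaussianPDFReal 0 1)
      (fun _ => integrable_gaussianPDFReal 0 1) fun _ => gaussianPDFReal_nonneg 0 1]
    unfold stdNormal
    rw [gaussianReal_of_var_ne_zero 0 one_ne_zero]
    rfl
  rw [h]
  exact withDensity_absolutelyContinuous _ _

/-! ### Monte-Carlo search -/

/-- Markov's inequality for the probability that none of `N` independent draws hits a set of
probability at least `p`. -/
lemma isLittleOpExp_miss {n : ℕ} {R : Set ((Fin n → ℝ) × (Fin n → ℝ))} (hR : MeasurableSet R)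
    {G : Set (Fin n → ℝ)} (hG : MeasurableSet G) {p : ℝ} (hp : 0 < p)
    (hpG : ∀ U ∈ G, p ≤ (stdNormal n).real {u | (U, u) ∈ R}) :
    IsLittleOpExp (p / 2) fun N V =>
      (stdNormal n).real {U | U ∈ G ∧ ∀ s : Fin N, (U, V s) ∉ R} := by
  intro η hη
  set P := stdNormal n with hP
  have hmeas : ∀ N, MeasurableSet
      {q : (Fin N → Fin n → ℝ) × (Fin n → ℝ) | q.2 ∈ G ∧ ∀ s, (q.2, q.1 s) ∉ R} := by
    intro N
    have e : {q : (Fin N → Fin n → ℝ) × (Fin n → ℝ) | q.2 ∈ G ∧ ∀ s, (q.2, q.1 s) ∉ R} =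
        Prod.snd ⁻¹' G ∩ ⋂ s, {q : (Fin N → Fin n → ℝ) × (Fin n → ℝ) | (q.2, q.1 s) ∈ R}ᶜ := by
      ext q; simp
    rw [e]
    refine (measurable_snd hG).inter (MeasurableSet.iInter fun s => ?_)
    exact ((measurable_snd.prodMk ((measurable_pi_apply s).comp measurable_fst)) hR).compl
  -- Fubini: for fixed `U` in `G` the draws are independent, so the miss probability is a power.
  have hint : ∀ N : ℕ, ∫⁻ V, P {U | U ∈ G ∧ ∀ s : Fin N, (U, V s) ∉ R}
      ∂(Measure.pi fun _ : Fin N => P) ≤ ENNReal.ofReal ((1 - p) ^ N) := by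
    intro N
    have h1 := Measure.prod_apply (μ := Measure.pi fun _ : Fin N => P) (ν := P) (hmeas N)
    have h2 := Measure.prod_apply_symm (μ := Measure.pi fun _ : Fin N => P) (ν := P) (hmeas N)
    have h3 : ∀ U, (Measure.pi fun _ : Fin N => P)
        ((fun V => (V, U)) ⁻¹' {q : (Fin N → Fin n → ℝ) × (Fin n → ℝ) |
          q.2 ∈ G ∧ ∀ s, (q.2, q.1 s) ∉ R}) ≤ ENNReal.ofReal ((1 - p) ^ N) := by
      intro U
      by_cases hU : U ∈ G
      · have hsec : MeasurableSet {u | (U, u) ∈ R} := measurable_prodMk_left hR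
        have e1 : (fun V : Fin N → Fin n → ℝ => (V, U)) ⁻¹'
            {q : (Fin N → Fin n → ℝ) × (Fin n → ℝ) | q.2 ∈ G ∧ ∀ s, (q.2, q.1 s) ∉ R} =
            Set.univ.pi fun _ => {u | (U, u) ∈ R}ᶜ := by
          ext V; simp [hU]
        rw [e1, Measure.pi_pi, Finset.prod_const, Finset.card_univ, Fintype.card_fin]
        have e2 : P {u | (U, u) ∈ R}ᶜ ≤ ENNReal.ofReal (1 - p) := by
          rw [← ofReal_measureReal, probReal_compl_eq_one_sub hsec]
          exact ENNReal.ofReal_le_ofReal (by linarith [hpG U hU])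
        have hp1 : p ≤ 1 := (hpG U hU).trans measureReal_le_one
        rw [ENNReal.ofReal_pow (by linarith)]
        gcongr
      · have e1 : (fun V : Fin N → Fin n → ℝ => (V, U)) ⁻¹'
            {q : (Fin N → Fin n → ℝ) × (Fin n → ℝ) | q.2 ∈ G ∧ ∀ s, (q.2, q.1 s) ∉ R} = ∅ := by
          ext V; simp [hU]
        rw [e1]; simp
    calc _ = ((Measure.pi fun _ : Fin N => P).prod P)
          {q : (Fin N → Fin n → ℝ) × (Fin n → ℝ) | q.2 ∈ G ∧ ∀ s, (q.2, q.1 s) ∉ R} := h1.symm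
      _ = _ := h2
      _ ≤ ∫⁻ _U, ENNReal.ofReal ((1 - p) ^ N) ∂P := lintegral_mono h3
      _ = _ := by simp
  by_cases hp1 : p ≤ 1
  swap
  · have hGe : G = ∅ := by
      by_contra hne
      obtain ⟨U, hU⟩ := Set.nonempty_iff_ne_empty.2 hne
      exact hp1 ((hpG U hU).trans measureReal_le_one)
    simp [hGe, not_le.2 hη]
  have hbound : ∀ N : ℕ, (Measure.pi fun _ : Fin N => P)
      {V | η ≤ |Real.exp (p / 2 * N) * P.real {U | U ∈ G ∧ ∀ s : Fin N, (U, V s) ∉ R}|} ≤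
      ENNReal.ofReal (η⁻¹ * Real.exp (-(p / 2)) ^ N) := by
    intro N
    have hmf : Measurable fun V : Fin N → Fin n → ℝ =>
        P {U | U ∈ G ∧ ∀ s : Fin N, (U, V s) ∉ R} :=
      measurable_measure_prodMk_left (hmeas N)
    have hpos : 0 < η * Real.exp (-(p / 2 * N)) := by positivity
    have hsub : {V : Fin N → Fin n → ℝ |
        η ≤ |Real.exp (p / 2 * N) * P.real {U | U ∈ G ∧ ∀ s : Fin N, (U, V s) ∉ R}|} ⊆
        {V | ENNReal.ofReal (η * Real.exp (-(p / 2 * N))) ≤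
          P {U | U ∈ G ∧ ∀ s : Fin N, (U, V s) ∉ R}} := by
      intro V hV
      simp only [Set.mem_ofPred_eq] at hV ⊢
      rw [abs_of_nonneg (by positivity)] at hV
      rw [← ofReal_measureReal]
      refine ENNReal.ofReal_le_ofReal ?_
      rw [Real.exp_neg]
      calc η * (Real.exp (p / 2 * N))⁻¹ ≤ Real.exp (p / 2 * N) *
          P.real {U | U ∈ G ∧ ∀ s : Fin N, (U, V s) ∉ R} * (Real.exp (p / 2 * N))⁻¹ := by gcongr
        _ = _ := by field_simp
    refine (measure_mono hsub).trans ((meas_ge_le_lintegral_div hmf.aemeasurable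
      (by simpa using hpos) ENNReal.ofReal_ne_top).trans ?_)
    refine (ENNReal.div_le_div_right (hint N) _).trans ?_
    rw [← ENNReal.ofReal_div_of_pos hpos]
    refine ENNReal.ofReal_le_ofReal ?_
    -- The mean miss probability is at most `exp (-p N)`; scaling by `exp (p N / 2)` still leaves
    -- decay `exp (-p N / 2)`.
    have h1 : 1 - p ≤ Real.exp (-p) := by linarith [Real.add_one_le_exp (-p)]
    have h2 : (1 - p) ^ N ≤ Real.exp (-p) ^ N := pow_le_pow_left₀ (by linarith) h1 N
    rw [div_le_iff₀ hpos]
    refine h2.trans (le_of_eq ?_)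
    rw [← Real.exp_nat_mul, ← Real.exp_nat_mul]
    have : Real.exp (N * -p) = Real.exp (N * -(p / 2)) * Real.exp (-(p / 2 * N)) := by
      rw [← Real.exp_add]; ring_nf
    rw [this]
    field_simp
  have hlim : Tendsto (fun N : ℕ => ENNReal.ofReal (η⁻¹ * Real.exp (-(p / 2)) ^ N)) atTop
      (𝓝 0) := by
    rw [← ENNReal.ofReal_zero]
    refine (ENNReal.continuous_ofReal.tendsto 0).comp ?_
    have := (tendsto_pow_atTop_nhds_zero_of_lt_one (Real.exp_pos (-(p / 2))).le
      (by rw [Real.exp_lt_one_iff]; linarith)).const_mul η⁻¹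
    simpa using this
  exact tendsto_of_tendsto_of_tendsto_of_le_of_le tendsto_const_nhds hlim
    (fun _ => zero_le) hbound

/-- If, with probability more than `1 - δ`, a single draw succeeds with positive probability,
then one of `N` draws succeeds with probability at least `1 - δ`, up to a remainder that is
exponentially small in `N`. -/
lemma exists_isLittleOpExp_search {n : ℕ} {R : Set ((Fin n → ℝ) × (Fin n → ℝ))}
    (hR : MeasurableSet R) {δ : ℝ}
    (h : 1 - δ < (stdNormal n).real {U | 0 < stdNormal n {u | (U, u) ∈ R}}) :
    ∃ c : ℝ, 0 < c ∧ ∃ ε : (N : ℕ) → (Fin N → Fin n → ℝ) → ℝ, IsLittleOpExp c ε ∧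
      ∀ N (V : Fin N → Fin n → ℝ),
        1 - δ - ε N V ≤ (stdNormal n).real {U | ∃ s, (U, V s) ∈ R} := by
  set P := stdNormal n with hP
  have hpm : Measurable fun U => P {u | (U, u) ∈ R} := measurable_measure_prodMk_left hR
  have hrm : Measurable fun U => P.real {u | (U, u) ∈ R} := hpm.ennreal_toReal
  -- Positive success probabilities need not be bounded away from zero; continuity from below yields
  -- a level `1 / (m + 1)` that loses too little mass to matter.
  have hU : {U | 0 < P {u | (U, u) ∈ R}} =
      ⋃ m : ℕ, {U | (1 : ℝ) / (m + 1) ≤ P.real {u | (U, u) ∈ R}} := by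
    ext U
    simp only [Set.mem_ofPred_eq, Set.mem_iUnion]
    constructor
    · intro h0
      have : 0 < P.real {u | (U, u) ∈ R} := ENNReal.toReal_pos h0.ne' (measure_ne_top _ _)
      obtain ⟨m, hm⟩ := exists_nat_one_div_lt this
      exact ⟨m, hm.le⟩
    · rintro ⟨m, hm⟩
      have : 0 < P.real {u | (U, u) ∈ R} := lt_of_lt_of_le (by positivity) hm
      exact (ENNReal.toReal_pos_iff.1 this).1
  have hmono : Monotone fun m : ℕ => {U | (1 : ℝ) / (m + 1) ≤ P.real {u | (U, u) ∈ R}} := by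
    intro a b hab U hUa
    have hab' : (a : ℝ) + 1 ≤ b + 1 := by exact_mod_cast Nat.succ_le_succ hab
    exact (one_div_le_one_div_of_le (by positivity) hab').trans
      hUa
  have hlim := tendsto_measure_iUnion_atTop (μ := P) hmono
  rw [← hU] at hlim
  have hlim' := (ENNReal.tendsto_toReal (measure_ne_top P _)).comp hlim
  obtain ⟨m, hm⟩ := (hlim'.eventually (lt_mem_nhds h)).exists
  set G := {U | (1 : ℝ) / (m + 1) ≤ P.real {u | (U, u) ∈ R}} with hGdef
  have hG : MeasurableSet G := measurableSet_le measurable_const hrm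
  have hm0 : (0 : ℝ) < 1 / (m + 1) := by positivity
  refine ⟨_, half_pos hm0, _,
    isLittleOpExp_miss hR hG hm0 fun U hU => hU, fun N V => ?_⟩
  have h1 : G ⊆ {U | U ∈ G ∧ ∀ s : Fin N, (U, V s) ∉ R} ∪ {U | ∃ s, (U, V s) ∈ R} := by
    intro U hUG
    by_cases hs : ∃ s, (U, V s) ∈ R
    · exact Or.inr hs
    · exact Or.inl ⟨hUG, by simpa using hs⟩
  have h2 := (measureReal_mono (μ := P) h1).trans (measureReal_union_le _ _)
  have h3 : 1 - δ < P.real G := hm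
  linarith

/-! ### Genericity of the noise -/

/-- A property holds almost surely if it holds at all but finitely many points of each line
parallel to the `i`-th coordinate axis. -/
lemma ae_stdNormal_of_line {n : ℕ} (i : Fin n) {p : (Fin n → ℝ) → Prop}
    (hp : MeasurableSet {U | p U}) (h : ∀ y, {t : ℝ | ¬ p (y + t • Pi.single i 1)}.Finite) :
    ∀ᵐ U ∂stdNormal n, p U := by
  refine (stdNormal_absolutelyContinuous n).ae_le ?_
  refine ae_mem_of_ae_add_linearMap_mem (LinearMap.toSpanSingleton ℝ _ (Pi.single i (1 : ℝ)))
    (volume : Measure ℝ) volume hp fun y => ?_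
  exact (h y).measure_zero volume

lemma finite_affine_zero {a b : ℝ} (h : a ≠ 0 ∨ b ≠ 0) : {t : ℝ | a * t + b = 0}.Finite := by
  by_cases ha : a = 0
  · have hb : b ≠ 0 := by tauto
    simp [ha, hb]
  · refine (Set.finite_singleton (-b / a)).subset fun t (ht : a * t + b = 0) => ?_
    rw [Set.mem_singleton_iff, eq_div_iff ha]
    linarith

lemma ae_affine_ne_zero {n : ℕ} {i j : Fin n} (hij : i ≠ j) (a b c : ℝ)
    (h : a ≠ 0 ∨ b ≠ 0 ∨ c ≠ 0) : ∀ᵐ U ∂stdNormal n, a * U i + b * U j + c ≠ 0 := by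
  have hs : MeasurableSet {U : Fin n → ℝ | a * U i + b * U j + c ≠ 0} :=
    (measurableSet_eq_fun (by fun_prop) measurable_const).compl
  by_cases ha : a = 0
  · refine ae_stdNormal_of_line j hs fun y => ?_
    refine (finite_affine_zero (a := b) (b := b * y j + c) ?_).subset fun t ht => ?_
    · by_cases hb : b = 0
      · right; simpa [hb, ha] using h
      · exact Or.inl hb
    · simp only [Set.mem_ofPred_eq, not_not, Pi.add_apply, Pi.smul_apply, Pi.single_eq_same,
        ha, smul_eq_mul] at ht ⊢
      linarith
  · refine ae_stdNormal_of_line i hs fun y => ?_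
    refine (finite_affine_zero (a := a) (b := a * y i + b * y j + c) (Or.inl ha)).subset
      fun t ht => ?_
    simp only [Set.mem_ofPred_eq, not_not, Pi.add_apply, Pi.smul_apply, Pi.single_eq_same,
      Pi.single_eq_of_ne hij.symm, smul_eq_mul] at ht ⊢
    linarith

lemma ae_ne {n : ℕ} {i j : Fin n} (hij : i ≠ j) : ∀ᵐ U ∂stdNormal n, U i - U j ≠ 0 := by
  filter_upwards [ae_affine_ne_zero hij 1 (-1) 0 (by simp)] with U hU h
  exact hU (by linarith)

/-- The determinant is affine in `U k`. Its slope is affine in `U i` and `U j` with constant term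
`μ₀ (M₀.label j) - μ₀ (M₀.label i)`, nonzero by injectivity, so it almost surely does not vanish. -/
lemma ae_triDet_ne_zero {n τ₀ : ℕ} (M₀ : Membership n τ₀) (μ₀ σ₀ : Fin τ₀ → ℝ)
    (hμ : Function.Injective μ₀) {i j k : Fin n} (hij : i ≠ j) (hik : i ≠ k) (hjk : j ≠ k)
    (hl : M₀.label i ≠ M₀.label j) :
    ∀ᵐ U ∂stdNormal n, triDet (M₀.sample μ₀ σ₀ U) U i j k ≠ 0 := by
  have hslope := ae_affine_ne_zero hij (σ₀ (M₀.label k) - σ₀ (M₀.label i))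
    (-(σ₀ (M₀.label k) - σ₀ (M₀.label j))) (μ₀ (M₀.label j) - μ₀ (M₀.label i))
    (Or.inr (Or.inr (sub_ne_zero.2 fun h => hl (hμ h).symm)))
  -- Stating the property as an implication makes lines of zero slope harmless: the slope does not
  -- depend on coordinate `k`.
  have hm : MeasurableSet {U : Fin n → ℝ |
      (σ₀ (M₀.label k) - σ₀ (M₀.label i)) * U i + -(σ₀ (M₀.label k) - σ₀ (M₀.label j)) * U j +
        (μ₀ (M₀.label j) - μ₀ (M₀.label i)) ≠ 0 →
      triDet (M₀.sample μ₀ σ₀ U) U i j k ≠ 0} := by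
    simp only [imp_iff_not_or, not_not]
    refine MeasurableSet.union ?_ (MeasurableSet.compl ?_)
    · exact measurableSet_eq_fun (by fun_prop) measurable_const
    · refine measurableSet_eq_fun ?_ measurable_const
      unfold triDet Membership.sample; fun_prop
  have hline := ae_stdNormal_of_line k hm fun y => by
    by_cases h0 : (σ₀ (M₀.label k) - σ₀ (M₀.label i)) * y i +
        -(σ₀ (M₀.label k) - σ₀ (M₀.label j)) * y j + (μ₀ (M₀.label j) - μ₀ (M₀.label i)) = 0
    · refine Set.Finite.subset Set.finite_empty fun t ht => ?_
      simp only [Set.mem_ofPred_eq, Classical.not_imp, Pi.add_apply, Pi.smul_apply,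
        Pi.single_eq_of_ne hik, Pi.single_eq_of_ne hjk, smul_zero, add_zero] at ht
      exact absurd h0 ht.1
    · refine (finite_affine_zero (b := triDet (M₀.sample μ₀ σ₀ y) y i j k)
        (Or.inl h0)).subset fun t ht => ?_
      simp only [Set.mem_ofPred_eq, not_not, Classical.not_imp, triDet, Membership.sample,
        Pi.add_apply, Pi.smul_apply, Pi.single_eq_same, Pi.single_eq_of_ne hik,
        Pi.single_eq_of_ne hjk, smul_eq_mul] at ht ⊢
      rw [← ht.2]
      ring
  filter_upwards [hslope, hline] with U h1 h2 using h2 h1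

/-! ### Separation -/

/-- If two means coincided, grouping observations by the value of their mean would use fewer
components and leave zero residual. -/
lemma injective_of_cMin_pos {n τ₀ : ℕ} (M₀ : Membership n τ₀) (μ₀ : Fin τ₀ → ℝ)
    (hC : 1 < τ₀ → 0 < cMin M₀ μ₀) : Function.Injective μ₀ := by
  classical
  rcases Nat.lt_or_ge 1 τ₀ with hτ | hτ
  swap
  · have : Subsingleton (Fin τ₀) := Fin.subsingleton_iff_le_one.2 hτ
    exact Function.injective_of_subsingleton _
  by_contra hinj
  set S := Finset.univ.image μ₀ with hS
  have hcard : S.card < τ₀ := by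
    refine lt_of_le_of_ne (Finset.card_image_le.trans (by simp)) fun h => hinj ?_
    have h' := Finset.card_image_iff.1 (h.trans (Finset.card_fin τ₀).symm)
    rwa [Finset.coe_univ, Set.injOn_univ] at h'
  let e := S.equivFin
  let lab : Fin n → Fin S.card := fun i => e ⟨μ₀ (M₀.label i), by simp [hS]⟩
  have hsurj : Function.Surjective lab := by
    intro k
    obtain ⟨l, -, hl⟩ := Finset.mem_image.1 (e.symm k).2
    obtain ⟨i, hi⟩ := M₀.surj l
    refine ⟨i, ?_⟩
    rw [← e.symm.injective.eq_iff]
    simp only [lab, Equiv.symm_apply_apply]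
    ext
    simp [hi, hl]
  let M : Membership n S.card := ⟨lab, hsurj⟩
  have hres : ∀ i, M.resid (fun j => μ₀ (M₀.label j)) i = 0 := by
    intro i
    have hmean : M.mean (fun j => μ₀ (M₀.label j)) (M.label i) = μ₀ (M₀.label i) := by
      unfold Membership.mean
      rw [Finset.sum_congr rfl (g := fun _ => μ₀ (M₀.label i))]
      · have := M.size_pos i
        rw [Finset.sum_const, nsmul_eq_mul, ← Membership.size]
        field_simp
      · intro j hj
        have h1 : lab j = lab i := (Finset.mem_filter.1 hj).2
        exact congrArg Subtype.val (e.injective h1)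
    rw [Membership.resid, hmean, sub_self]
  have hle : cMin M₀ μ₀ ≤ 0 := by
    refine (ciInf_le ⟨0, ?_⟩ (⟨⟨S.card, M⟩, hcard⟩ :
      {p : Σ τ : ℕ, Membership n τ // p.1 < τ₀})).trans ?_
    · rintro _ ⟨p, rfl⟩
      exact Real.sqrt_nonneg _
    · simp [hres]
  exact absurd (hC hτ) (not_lt.2 hle)

/-! ### The relation `closeNoise` -/

/-- Strict inequalities are used throughout so that a section containing one point has positive
Gaussian mass. -/
lemma isOpen_closeNoise {n τ₀ : ℕ} (M₀ : Membership n τ₀) (μ₀ σ₀ : Fin τ₀ → ℝ) (γ : ℝ) :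
    IsOpen (closeNoise M₀ μ₀ σ₀ γ) := by
  unfold closeNoise
  simp only [Set.ofPred_and, Set.ofPred_forall]
  refine IsOpen.inter ?_ (IsOpen.inter ?_ ?_)
  · repeat refine isOpen_iInter_of_finite fun _ => ?_
    unfold triSpread triDet Membership.sample
    exact isOpen_lt (by fun_prop) (by fun_prop)
  · exact isOpen_lt (by fun_prop) (by fun_prop)
  · repeat refine isOpen_iInter_of_finite fun _ => ?_
    exact isOpen_lt (by fun_prop) (by fun_prop)

lemma tendsto_fitGap (κ : ℝ) : Tendsto (fitGap κ) (𝓝 0) (𝓝 0) := by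
  have h : ContinuousAt (fitGap κ) 0 := by
    unfold fitGap
    have : ContinuousAt (fun γ : ℝ => γ ^ (1.5 : ℝ)) 0 :=
      Real.continuousAt_rpow_const 0 _ (Or.inr (by norm_num))
    fun_prop
  have h0 : fitGap κ 0 = 0 := by
    unfold fitGap
    rw [Real.zero_rpow (by norm_num)]; ring
  simpa [ContinuousAt, h0] using h

/-- On the diagonal the distance is zero and the order condition is a nonzero square; the
determinants are almost surely nonzero while `fitGap` tends to zero. -/
lemma tendsto_measure_closeNoise_diag {n τ₀ : ℕ} (M₀ : Membership n τ₀) (μ₀ σ₀ : Fin τ₀ → ℝ)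
    (hμ : Function.Injective μ₀) {g : ℕ → ℝ} (hg : ∀ m, 0 < g m)
    (hlim : Tendsto g atTop (𝓝 0)) :
    Tendsto (fun m => (stdNormal n).real {U | (U, U) ∈ closeNoise M₀ μ₀ σ₀ (g m)}) atTop (𝓝 1) := by
  have hmeas : ∀ m, MeasurableSet {U | (U, U) ∈ closeNoise M₀ μ₀ σ₀ (g m)} := fun m =>
    ((isOpen_closeNoise M₀ μ₀ σ₀ (g m)).preimage
      (continuous_id.prodMk continuous_id)).measurableSet
  have hae : ∀ᵐ U ∂stdNormal n, ∀ᶠ m in atTop,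
      U ∈ {U | (U, U) ∈ closeNoise M₀ μ₀ σ₀ (g m)} ↔ U ∈ Set.univ := by
    have h1 : ∀ᵐ U ∂stdNormal n, ∀ i j k : Fin n, i ≠ j → i ≠ k → j ≠ k →
        M₀.label i ≠ M₀.label j → triDet (M₀.sample μ₀ σ₀ U) U i j k ≠ 0 := by
      simp only [ae_all_iff]
      exact fun i j k hij hik hjk hl => ae_triDet_ne_zero M₀ μ₀ σ₀ hμ hij hik hjk hl
    have h2 : ∀ᵐ U ∂stdNormal n, ∀ i j : Fin n, i ≠ j → U i - U j ≠ 0 := by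
      simp only [ae_all_iff]
      exact fun i j hij => ae_ne hij
    filter_upwards [h1, h2] with U hU1 hU2
    simp only [Set.mem_univ, iff_true]
    have h3 : ∀ᶠ m in atTop, ∀ i j k : Fin n, i ≠ j → i ≠ k → j ≠ k →
        M₀.label i ≠ M₀.label j → fitGap (sepConst M₀ μ₀ σ₀) (g m) * triSpread U i j k <
          triDet (M₀.sample μ₀ σ₀ U) U i j k ^ 2 := by
      simp only [eventually_all]
      intro i j k hij hik hjk hl
      have ht : Tendsto (fun m => fitGap (sepConst M₀ μ₀ σ₀) (g m) * triSpread U i j k) atTop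
          (𝓝 (0 * triSpread U i j k)) := ((tendsto_fitGap _).comp hlim).mul_const _
      rw [zero_mul] at ht
      exact ht.eventually (gt_mem_nhds (by have := hU1 i j k hij hik hjk hl; positivity))
    filter_upwards [h3] with m hm
    refine ⟨hm, ?_, fun i j hij => ?_⟩
    · simpa using Real.rpow_pos_of_pos (hg m) _
    · have := hU2 i j hij
      exact mul_self_pos.2 this
  have := tendsto_measure_of_ae_tendsto_indicator_of_isFiniteMeasure atTop MeasurableSet.univ
    hmeas hae
  rw [measure_univ] at this
  exact (ENNReal.tendsto_toReal ENNReal.one_ne_top).comp this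

/-- The penalty range has positive width for small `γ`. -/
lemma eventually_lamLower_lt_lamUpper {n τ₀ : ℕ} (hn : 1 < n) (M₀ : Membership n τ₀)
    (μ₀ σ₀ : Fin τ₀ → ℝ) (hσ₀ : ∀ k, 0 < σ₀ k) (hτ : 1 < τ₀) (hC : 0 < cMin M₀ μ₀) :
    ∀ᶠ γ in 𝓝[>] 0, lamLower n γ < lamUpper M₀ μ₀ σ₀ γ := by
  have : Nonempty (Fin τ₀) := ⟨⟨0, by omega⟩⟩
  obtain ⟨a, ha⟩ := exists_eq_ciInf_of_finite (f := σ₀)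
  have hinf : 0 < ⨅ k, σ₀ k := ha ▸ hσ₀ a
  have hsup : 0 < ⨆ k, σ₀ k := (hσ₀ a).trans_le (le_ciSup (Set.finite_range σ₀).bddAbove a)
  have hκ : 0 < sepConst M₀ μ₀ σ₀ := by unfold sepConst; positivity
  set κ := sepConst M₀ μ₀ σ₀
  have hn' : (0 : ℝ) < n := by exact_mod_cast (by omega : 0 < n)
  have hlogn : 0 < Real.log n := Real.log_pos (by exact_mod_cast hn)
  have hτ' : (0 : ℝ) < τ₀ := by exact_mod_cast (by omega : 0 < τ₀)
  -- The exponent `1.5` exceeds one, so the lower end is negligible against the linear growth of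
  -- `log (1 + κ * γ)`.
  have h1 : ∀ᶠ γ : ℝ in 𝓝[>] 0, 2 * τ₀ * γ ^ (0.5 : ℝ) < κ / 2 := by
    have hc : ContinuousAt (fun γ : ℝ => 2 * τ₀ * γ ^ (0.5 : ℝ)) 0 :=
      (Real.continuousAt_rpow_const 0 _ (Or.inr (by norm_num))).const_mul _
    have hc' := hc.tendsto
    rw [Real.zero_rpow (by norm_num), mul_zero] at hc'
    exact (hc'.mono_left nhdsWithin_le_nhds).eventually (gt_mem_nhds (by positivity))
  have h2 : ∀ᶠ γ : ℝ in 𝓝[>] 0, γ < 1 / κ :=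
    nhdsWithin_le_nhds (gt_mem_nhds (by positivity))
  filter_upwards [h1, h2, self_mem_nhdsWithin] with γ h1 h2 (hγ : 0 < γ)
  have hx : κ * γ < 1 := by rwa [lt_div_iff₀ hκ, mul_comm] at h2
  have hlog : κ * γ / 2 ≤ Real.log (1 + κ * γ) := by
    have hinv := Real.one_sub_inv_le_log_of_pos (by positivity : 0 < 1 + κ * γ)
    refine le_trans ?_ hinv
    have : 1 - (1 + κ * γ)⁻¹ = κ * γ / (1 + κ * γ) := by field_simp; ring
    rw [this]
    gcongr
    linarith
  have hpow : γ ^ (1.5 : ℝ) = γ * γ ^ (0.5 : ℝ) := by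
    rw [show (1.5 : ℝ) = 1 + 0.5 by norm_num, Real.rpow_add hγ, Real.rpow_one]
  have hmain : 2 * τ₀ * γ ^ (1.5 : ℝ) < Real.log (1 + κ * γ) := by
    rw [hpow]
    nlinarith
  rw [lamUpper_eq, lamLower, div_lt_div_iff₀ (by positivity) (by positivity)]
  calc γ ^ (1.5 : ℝ) * (2 * τ₀ * Real.log n / n)
      = 2 * τ₀ * γ ^ (1.5 : ℝ) * (Real.log n / n) := by ring
    _ < _ := by gcongr

/-! ### Independence of location, scale and direction -/

/-- Identity theorem on the strip `|Re z| < r`: agreement near zero on the real line propagates to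
`Complex.I`, where characteristic functions are read off. -/
lemma complexMGF_I_eq_of_mgf_eq {Ω : Type*} [MeasurableSpace Ω] {μ μ' : Measure Ω} {X : Ω → ℝ}
    {r : ℝ} (hr : 0 < r)
    (hμ : ∀ z ∈ Set.Ioo (-r) r, Integrable (fun ω => Real.exp (z * X ω)) μ)
    (hμ' : ∀ z ∈ Set.Ioo (-r) r, Integrable (fun ω => Real.exp (z * X ω)) μ')
    (h : ∀ z ∈ Set.Ioo (-r) r, mgf X μ z = mgf X μ' z) :
    complexMGF X μ Complex.I = complexMGF X μ' Complex.I := by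
  set S : Set ℂ := {z | z.re ∈ Set.Ioo (-r) r} with hS
  have hsub : Set.Ioo (-r) r ⊆ interior (integrableExpSet X μ) :=
    interior_maximal hμ isOpen_Ioo
  have hsub' : Set.Ioo (-r) r ⊆ interior (integrableExpSet X μ') :=
    interior_maximal hμ' isOpen_Ioo
  have hX : AnalyticOnNhd ℂ (complexMGF X μ) S :=
    analyticOnNhd_complexMGF.mono fun z hz => hsub hz
  have hY : AnalyticOnNhd ℂ (complexMGF X μ') S :=
    analyticOnNhd_complexMGF.mono fun z hz => hsub' hz
  have hpre : IsPreconnected S :=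
    ((convex_Ioo (-r) r).linear_preimage Complex.reLm).isPreconnected
  have key : Set.EqOn (complexMGF X μ) (complexMGF X μ') S := by
    refine AnalyticOnNhd.eqOn_of_preconnected_of_frequently_eq hX hY hpre
      (z₀ := ((0 : ℝ) : ℂ)) (by simp [hS, hr]) ?_
    have h_real : ∃ᶠ x : ℝ in 𝓝[≠] 0, complexMGF X μ x = complexMGF X μ' x := by
      refine Eventually.frequently ?_
      filter_upwards [nhdsWithin_le_nhds (Ioo_mem_nhds (neg_lt_zero.2 hr) hr)] with x hx
      rw [complexMGF_ofReal, complexMGF_ofReal, h x hx]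
    rw [frequently_iff_seq_forall] at h_real ⊢
    obtain ⟨xs, hx_tendsto, hx_eq⟩ := h_real
    refine ⟨fun n => xs n, ?_, fun n => ?_⟩
    · rw [tendsto_nhdsWithin_iff] at hx_tendsto ⊢
      constructor
      · rw [tendsto_ofReal_iff]
        exact hx_tendsto.1
      · simpa using hx_tendsto.2
    · simp [hx_eq]
  exact key (by simp [hS, hr])

/-- Reweighting the standard normal law by an exponential of a quadratic polynomial gives an
affine image of it. -/
lemma exists_gaussianReal_withDensity_eq_map (a b : ℝ) (hb : b < 1 / 2) :
    ∃ c m s : ℝ, 0 < c ∧ 0 < s ∧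
      Integrable (fun x => c * Real.exp (a * x + b * x ^ 2)) (gaussianReal 0 1) ∧
      (gaussianReal 0 1).withDensity (fun x => ENNReal.ofReal (c * Real.exp (a * x + b * x ^ 2))) =
        (gaussianReal 0 1).map fun x => m + s * x := by
  have hb' : 0 < 1 - 2 * b := by linarith
  -- Completing the square: the tilted law has variance `v` and mean `a * v`, and `c` normalizes it.
  set v : ℝ := 1 / (1 - 2 * b) with hv
  have hv0 : 0 < v := by positivity
  set c : ℝ := (√v)⁻¹ * Real.exp (-(a * v) ^ 2 / (2 * v)) with hc
  have hc0 : 0 < c := by positivity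
  have hmap : (gaussianReal 0 1).map (fun x => a * v + √v * x) =
      gaussianReal (a * v) v.toNNReal := by
    have h1 : (fun x => a * v + √v * x) = (fun x => a * v + x) ∘ fun x => √v * x := rfl
    rw [h1, ← Measure.map_map (by fun_prop) (by fun_prop), gaussianReal_map_const_mul,
      gaussianReal_map_const_add]
    congr 1
    · ring
    · ext
      simp [Real.sq_sqrt hv0.le, hv0.le]
  have hvn : v.toNNReal ≠ 0 := by simpa using hv0
  have hpdf : ∀ x, gaussianPDFReal 0 1 x * (c * Real.exp (a * x + b * x ^ 2)) =
      gaussianPDFReal (a * v) v.toNNReal x := by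
    intro x
    have e1 : Real.exp (-(x - a * v) ^ 2 / (2 * v)) = Real.exp (-(a * v) ^ 2 / (2 * v)) *
        Real.exp (a * x + b * x ^ 2) * Real.exp (-x ^ 2 / 2) := by
      rw [← Real.exp_add, ← Real.exp_add]
      congr 1
      rw [hv]; field_simp; ring
    simp only [gaussianPDFReal, Real.coe_toNNReal v hv0.le, NNReal.coe_one, mul_one, sub_zero]
    rw [e1, hc, Real.sqrt_mul (x := 2 * Real.pi) (by positivity), mul_inv]
    ring
  have hwd : (gaussianReal 0 1).withDensity
      (fun x => ENNReal.ofReal (c * Real.exp (a * x + b * x ^ 2))) =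
      gaussianReal (a * v) v.toNNReal := by
    rw [gaussianReal_of_var_ne_zero 0 one_ne_zero, gaussianReal_of_var_ne_zero _ hvn,
      ← withDensity_mul _ (measurable_gaussianPDF 0 1) (by fun_prop)]
    congr 1
    ext x
    rw [Pi.mul_apply, gaussianPDF, gaussianPDF, ← hpdf,
      ENNReal.ofReal_mul (gaussianPDFReal_nonneg 0 1 x)]
  refine ⟨c, a * v, √v, hc0, by positivity, ⟨by fun_prop, ?_⟩, hwd.trans hmap.symm⟩
  rw [hasFiniteIntegral_iff_ofReal (ae_of_all _ fun x => by positivity)]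
  have := congrArg (fun κ : Measure ℝ => κ Set.univ) hwd
  simp only [withDensity_apply _ MeasurableSet.univ, Measure.restrict_univ, measure_univ] at this
  rw [this]
  exact ENNReal.one_lt_top

/-- Coordinates in one component share the tilt, hence also location and scale, so the affine image
is given by `M.sample`. -/
lemma exists_stdNormal_withDensity_eq_map {n τ : ℕ} (M : Membership n τ) (a b : Fin τ → ℝ)
    (hb : ∀ k, b k < 1 / 2) :
    ∃ (c : ℝ) (m s : Fin τ → ℝ), 0 < c ∧ (∀ k, 0 < s k) ∧
      Integrable (fun x => Real.exp (∑ i, (a (M.label i) * x i + b (M.label i) * x i ^ 2)))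
        (stdNormal n) ∧
      (stdNormal n).withDensity (fun x => ENNReal.ofReal
        (c * Real.exp (∑ i, (a (M.label i) * x i + b (M.label i) * x i ^ 2)))) =
        (stdNormal n).map (M.sample m s) := by
  choose c m s hc hs hint hmap using fun k =>
    exists_gaussianReal_withDensity_eq_map (a k) (b k) (hb k)
  have hprod : ∀ x : Fin n → ℝ, ∏ i, (c (M.label i) *
      Real.exp (a (M.label i) * x i + b (M.label i) * x i ^ 2)) = (∏ i, c (M.label i)) *
      Real.exp (∑ i, (a (M.label i) * x i + b (M.label i) * x i ^ 2)) := by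
    intro x
    rw [Finset.prod_mul_distrib, Real.exp_sum]
  have hc' : 0 < ∏ i, c (M.label i) := Finset.prod_pos fun i _ => hc _
  refine ⟨∏ i, c (M.label i), m, s, hc', hs, ?_, ?_⟩
  · have h1 : Integrable (fun x : Fin n → ℝ => ∏ i, (c (M.label i) *
        Real.exp (a (M.label i) * x i + b (M.label i) * x i ^ 2))) (stdNormal n) :=
      Integrable.fintype_prod_dep (f := fun i x => c (M.label i) *
        Real.exp (a (M.label i) * x + b (M.label i) * x ^ 2)) fun i => hint (M.label i)
    simp only [hprod] at h1
    exact (integrable_const_mul_iff (Ne.isUnit hc'.ne') _).1 h1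
  · have h2 := pi_withDensity_ofReal (fun _ : Fin n => gaussianReal 0 1)
      (fun i x => c (M.label i) * Real.exp (a (M.label i) * x + b (M.label i) * x ^ 2))
      (fun i => hint _) fun i x => mul_nonneg (hc _).le (Real.exp_pos _).le
    simp only [hprod, hmap] at h2
    rw [stdNormal, ← h2, ← Measure.pi_map_pi (fun i => by fun_prop)]
    rfl

/-- An event that is invariant under changes of location and scale in each component is
uncorrelated with each exponential of a quadratic polynomial. -/
lemma setIntegral_exp_quadratic {n τ : ℕ} (M : Membership n τ) (a b : Fin τ → ℝ)
    (hb : ∀ k, b k < 1 / 2) :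
    Integrable (fun x => Real.exp (∑ i, (a (M.label i) * x i + b (M.label i) * x i ^ 2)))
      (stdNormal n) ∧
    ∀ A : Set (Fin n → ℝ), MeasurableSet A →
      (∀ m s : Fin τ → ℝ, (∀ k, 0 < s k) → M.sample m s ⁻¹' A = A) →
      ∫ x in A, Real.exp (∑ i, (a (M.label i) * x i + b (M.label i) * x i ^ 2)) ∂stdNormal n =
        (stdNormal n).real A *
        ∫ x, Real.exp (∑ i, (a (M.label i) * x i + b (M.label i) * x i ^ 2)) ∂stdNormal n := by
  obtain ⟨c, m, s, hc, hs, hint, hwd⟩ := exists_stdNormal_withDensity_eq_map M a b hb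
  refine ⟨hint, ?_⟩
  have hsm : Measurable (M.sample m s) := by unfold Membership.sample; fun_prop
  have key : ∀ A : Set (Fin n → ℝ), MeasurableSet A →
      (∀ m s : Fin τ → ℝ, (∀ k, 0 < s k) → M.sample m s ⁻¹' A = A) →
      c * ∫ x in A, Real.exp (∑ i, (a (M.label i) * x i + b (M.label i) * x i ^ 2)) ∂stdNormal n =
        (stdNormal n).real A := by
    intro A hA hinv
    have h1 := congrArg (fun κ : Measure (Fin n → ℝ) => κ A) hwd
    simp only [withDensity_apply _ hA, Measure.map_apply hsm hA, hinv m s hs] at h1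
    rw [← ofReal_integral_eq_lintegral_ofReal (hint.restrict.const_mul c)
      (ae_of_all _ fun x => by positivity), integral_const_mul] at h1
    rw [Measure.real, ← h1, ENNReal.toReal_ofReal]
    exact mul_nonneg hc.le (integral_nonneg fun x => (Real.exp_pos _).le)
  intro A hA hinv
  have h1 := key A hA hinv
  -- The whole space is invariant too, which identifies `c` as the inverse of the full integral.
  have h2 := key Set.univ MeasurableSet.univ fun _ _ _ => rfl
  rw [setIntegral_univ, probReal_univ] at h2
  rw [← h1]
  linear_combination (-∫ x in A, Real.exp
    (∑ i, (a (M.label i) * x i + b (M.label i) * x i ^ 2)) ∂stdNormal n) * h2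

namespace Membership

variable {n τ : ℕ} (M : Membership n τ)

/-- The sums and the sums of squares over the components. -/
noncomputable def powerSums (x : Fin n → ℝ) : EuclideanSpace ℝ (Fin τ ⊕ Fin τ) :=
  WithLp.toLp 2 (Sum.elim (fun k => ∑ i ∈ M.block k, x i) fun k => ∑ i ∈ M.block k, x i ^ 2)

lemma measurable_powerSums : Measurable M.powerSums := by
  refine (WithLp.measurable_toLp 2 _).comp (measurable_pi_lambda _ fun k => ?_)
  rcases k with k | k <;> simp only [Sum.elim_inl, Sum.elim_inr] <;> fun_prop

lemma sum_block (f : Fin τ → Fin n → ℝ) :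
    ∑ k, ∑ i ∈ M.block k, f k i = ∑ i, f (M.label i) i := by
  rw [← Finset.sum_fiberwise (s := Finset.univ) (g := M.label)]
  refine Finset.sum_congr rfl fun k _ => Finset.sum_congr rfl fun i hi => ?_
  rw [(Finset.mem_filter.1 hi).2]

lemma inner_powerSums (x : Fin n → ℝ) (t : EuclideanSpace ℝ (Fin τ ⊕ Fin τ)) :
    inner ℝ (M.powerSums x) t =
      ∑ i, (t (Sum.inl (M.label i)) * x i + t (Sum.inr (M.label i)) * x i ^ 2) := by
  rw [PiLp.inner_apply, Fintype.sum_sum_type, Finset.sum_add_distrib,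
    ← M.sum_block fun k i => t (Sum.inl k) * x i,
    ← M.sum_block fun k i => t (Sum.inr k) * x i ^ 2]
  simp only [powerSums, RCLike.inner_apply, conj_trivial, Sum.elim_inl, Sum.elim_inr,
    Finset.mul_sum]

/-- An event that is invariant under changes of location and scale in each component is
independent of the sums and the sums of squares. -/
lemma map_powerSums_restrict {A : Set (Fin n → ℝ)} (hA : MeasurableSet A)
    (hinv : ∀ m s : Fin τ → ℝ, (∀ k, 0 < s k) → M.sample m s ⁻¹' A = A) :
    ((stdNormal n).restrict A).map M.powerSums =
      ((stdNormal n) A • stdNormal n).map M.powerSums := by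
  have hfin : IsFiniteMeasure ((stdNormal n) A • stdNormal n) :=
    (stdNormal n).smul_finite (measure_ne_top _ _)
  refine Measure.ext_of_charFun (funext fun t => ?_)
  have hm := M.measurable_powerSums
  have hchar : ∀ κ : Measure (Fin n → ℝ), charFun (κ.map M.powerSums) t =
      complexMGF (fun x => inner ℝ (M.powerSums x) t) κ Complex.I := by
    intro κ
    rw [charFun_apply, integral_map hm.aemeasurable (by fun_prop), complexMGF]
    simp only [mul_comm]
  rw [hchar, hchar]
  -- For small `z` every quadratic coefficient stays below `1 / 2`, the threshold for Gaussian
  -- integrability.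
  obtain ⟨r, hr, hrt⟩ : ∃ r : ℝ, 0 < r ∧ ∀ z ∈ Set.Ioo (-r) r, ∀ k : Fin τ,
      z * t (Sum.inr k) < 1 / 2 := by
    refine ⟨1 / (2 * (1 + ‖t‖)), by positivity, fun z hz k => ?_⟩
    have h1 : |z| < 1 / (2 * (1 + ‖t‖)) := abs_lt.2 hz
    have h2 : |t (Sum.inr k)| ≤ ‖t‖ := PiLp.norm_apply_le t _
    calc z * t (Sum.inr k) ≤ |z| * |t (Sum.inr k)| := by
          rw [← abs_mul]; exact le_abs_self _
      _ ≤ |z| * (1 + ‖t‖) := by gcongr; linarith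
      _ < 1 / (2 * (1 + ‖t‖)) * (1 + ‖t‖) := by gcongr
      _ = 1 / 2 := by field_simp
  have hexp : ∀ z : ℝ, (fun x => Real.exp (z * inner ℝ (M.powerSums x) t)) = fun x =>
      Real.exp (∑ i, (z * t (Sum.inl (M.label i)) * x i +
        z * t (Sum.inr (M.label i)) * x i ^ 2)) := by
    intro z
    ext x
    rw [inner_powerSums, Finset.mul_sum]
    simp only [mul_add, mul_assoc]
  have hmain : ∀ z ∈ Set.Ioo (-r) r, _ := fun z hz =>
    setIntegral_exp_quadratic M (fun k => z * t (Sum.inl k)) (fun k => z * t (Sum.inr k)) (hrt z hz)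
  refine complexMGF_I_eq_of_mgf_eq hr (fun z hz => ?_) (fun z hz => ?_) fun z hz => ?_
  · rw [hexp]
    exact (hmain z hz).1.restrict
  · rw [hexp]
    exact (hmain z hz).1.smul_measure (measure_ne_top _ _)
  · rw [mgf, mgf, hexp, (hmain z hz).2 A hA hinv, integral_smul_measure]
    rfl

lemma mean_sample (m s : Fin τ → ℝ) (x : Fin n → ℝ) (k : Fin τ) :
    M.mean (M.sample m s x) k = m k + s k * M.mean x k := by
  obtain ⟨i, rfl⟩ := M.surj k
  have hpos : (0 : ℝ) < M.size (M.label i) := by exact_mod_cast M.size_pos i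
  have h : ∑ j ∈ M.block (M.label i), M.sample m s x j =
      M.size (M.label i) * m (M.label i) + s (M.label i) * ∑ j ∈ M.block (M.label i), x j := by
    rw [Finset.mul_sum, ← nsmul_eq_mul, size, ← Finset.sum_const, ← Finset.sum_add_distrib]
    refine Finset.sum_congr rfl fun j hj => ?_
    rw [sample, (Finset.mem_filter.1 hj).2]
  rw [mean, mean, h]
  field_simp

lemma resid_sample (m s : Fin τ → ℝ) (x : Fin n → ℝ) (i : Fin n) :
    M.resid (M.sample m s x) i = s (M.label i) * M.resid x i := by
  rw [resid, resid, mean_sample, sample]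
  ring

lemma scale_sample (m s : Fin τ → ℝ) (hs : ∀ k, 0 < s k) (x : Fin n → ℝ) (k : Fin τ) :
    M.scale (M.sample m s x) k = s k * M.scale x k := by
  have h : ∑ i ∈ M.block k, M.resid (M.sample m s x) i ^ 2 =
      s k ^ 2 * ∑ i ∈ M.block k, M.resid x i ^ 2 := by
    rw [Finset.mul_sum]
    refine Finset.sum_congr rfl fun i hi => ?_
    rw [resid_sample, (Finset.mem_filter.1 hi).2, mul_pow]
  rw [scale, scale, h, Real.sqrt_mul (sq_nonneg _), Real.sqrt_sq (hs k).le]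

lemma direction_sample (m s : Fin τ → ℝ) (hs : ∀ k, 0 < s k) (x : Fin n → ℝ) :
    M.direction (M.sample m s x) = M.direction x := by
  ext i
  rw [direction, direction, resid_sample, scale_sample M m s hs,
    mul_div_mul_left _ _ (hs _).ne']

lemma measurable_mean : Measurable M.mean := by
  unfold mean; fun_prop

lemma measurable_resid : Measurable M.resid := by
  have := M.measurable_mean
  unfold resid; fun_prop

lemma measurable_scale : Measurable M.scale := by
  have := M.measurable_resid
  unfold scale; fun_prop

lemma measurable_direction : Measurable M.direction := by
  have := M.measurable_resid
  have := M.measurable_scale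
  unfold direction; fun_prop

/-- An argument in the spirit of Basu's theorem: events defined by the direction are invariant under
location and scale changes. -/
lemma indepFun_powerSums_direction : IndepFun M.powerSums M.direction (stdNormal n) := by
  rw [indepFun_iff_measure_inter_preimage_eq_mul]
  intro s t hs ht
  have hA := M.measurable_direction ht
  have h := map_powerSums_restrict M hA fun m s' hs' => by
    ext x
    simp [direction_sample M m s' hs']
  have h' := congrArg (fun κ : Measure _ => κ s) h
  simp only [Measure.map_apply M.measurable_powerSums hs,
    Measure.restrict_apply (M.measurable_powerSums hs), Measure.smul_apply, smul_eq_mul] at h'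
  rw [h', mul_comm]

lemma sum_resid_sq (x : Fin n → ℝ) (k : Fin τ) :
    ∑ i ∈ M.block k, M.resid x i ^ 2 =
      ∑ i ∈ M.block k, x i ^ 2 - (∑ i ∈ M.block k, x i) ^ 2 / M.size k := by
  obtain ⟨i, rfl⟩ := M.surj k
  have hpos : (0 : ℝ) < M.size (M.label i) := by exact_mod_cast M.size_pos i
  have h : ∀ j ∈ M.block (M.label i), M.resid x j ^ 2 =
      x j ^ 2 - 2 * M.mean x (M.label i) * x j + M.mean x (M.label i) ^ 2 := by
    intro j hj
    rw [resid, (Finset.mem_filter.1 hj).2]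
    ring
  rw [Finset.sum_congr rfl h, Finset.sum_add_distrib, Finset.sum_sub_distrib, ← Finset.mul_sum,
    Finset.sum_const, nsmul_eq_mul, ← size, mean]
  field_simp
  ring

/-- Component means and residual norms of a sample are independent of the residual directions of
its noise. -/
lemma indepFun_mean_scale_direction (μ σ : Fin τ → ℝ) (hσ : ∀ k, 0 < σ k) :
    IndepFun (fun U => (M.mean (M.sample μ σ U), M.scale (M.sample μ σ U))) M.direction
      (stdNormal n) := by
  let φ : EuclideanSpace ℝ (Fin τ ⊕ Fin τ) → (Fin τ → ℝ) × (Fin τ → ℝ) := fun t =>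
    (fun k => μ k + σ k * (t (Sum.inl k) / M.size k),
      fun k => σ k * √(t (Sum.inr k) - t (Sum.inl k) ^ 2 / M.size k))
  have hφ : Measurable φ := by fun_prop
  have h := M.indepFun_powerSums_direction.comp hφ measurable_id
  refine (IndepFun.congr h (ae_of_all _ fun U => ?_) (ae_of_all _ fun U => rfl))
  refine Prod.ext (funext fun k => ?_) (funext fun k => ?_)
  · simp only [mean_sample]
    rfl
  · simp only [scale_sample M μ σ hσ]
    rw [scale, sum_resid_sq]
    rfl

lemma resid_eq_scale_mul_direction (x : Fin n → ℝ) (i : Fin n) :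
    M.resid x i = M.scale x (M.label i) * M.direction x i := by
  rw [direction]
  -- A zero scale makes all residuals of the block vanish, so the convention for division by zero is
  -- consistent.
  by_cases h : M.scale x (M.label i) = 0
  · have h0 := (Real.sqrt_eq_zero (Finset.sum_nonneg fun _ _ => sq_nonneg _)).1 h
    have := (Finset.sum_eq_zero_iff_of_nonneg fun _ _ => sq_nonneg _).1 h0 i (by simp [block])
    rw [h, zero_mul]
    exact pow_eq_zero_iff two_ne_zero |>.1 this
  · field_simp

/-- Data and noise share their directions, so mean, scale and direction recombine to the data. -/
lemma repro_self (μ σ : Fin τ → ℝ) (hσ : ∀ k, 0 < σ k) (U : Fin n → ℝ) :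
    M.repro (M.sample μ σ U) U = M.sample μ σ U := by
  ext i
  have h := M.resid_eq_scale_mul_direction (M.sample μ σ U) i
  rw [direction_sample M μ σ hσ] at h
  rw [repro, sample, ← h, resid]
  ring

end Membership

/-! ### Coverage of the nuclear statistic -/

/-- For a law on `ℕ`, the values for which the more likely ones have total probability at most
`α` have probability at least `α`. -/
lemma le_measure_level_set (κ : Measure ℕ) [IsProbabilityMeasure κ] {α : ℝ} (hα : α < 1) :
    α ≤ κ.real {t | κ.real {t' | κ.real {t} < κ.real {t'}} ≤ α} := by
  set A := {t | κ.real {t' | κ.real {t} < κ.real {t'}} ≤ α} with hA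
  by_contra! hlt
  obtain ⟨t, htA, ht⟩ : ∃ t ∈ Aᶜ, 0 < κ.real {t} := by
    by_contra! hno
    have h0 : κ Aᶜ = 0 := by
      rw [← Set.biUnion_of_singleton Aᶜ, measure_biUnion_null_iff (Set.to_countable _)]
      intro t ht
      exact (measureReal_eq_zero_iff).1 (le_antisymm (hno t ht) measureReal_nonneg)
    have h1 := probReal_compl_eq_one_sub (μ := κ) (s := A) (MeasurableSet.of_discrete)
    rw [Measure.real, h0, ENNReal.toReal_zero] at h1
    linarith
  have hfin : {t' | ENNReal.ofReal (κ.real {t}) ≤ κ {t'}}.Finite := by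
    refine Measure.finite_const_le_meas_of_disjoint_iUnion κ
      (by simpa only [ENNReal.ofReal_pos] using ht) (fun _ => MeasurableSet.of_discrete) (fun i j hij => by simpa using hij) (measure_ne_top _ _)
  -- Only finitely many atoms have at least a given mass, so the complement has a most likely value
  -- `m`. All likelier values lie in `A`, whose mass is below `α`, against `m ∉ A`.
  obtain ⟨m, ⟨hmA, -⟩, hmax⟩ := Set.exists_max_image
    (Aᶜ ∩ {t' | ENNReal.ofReal (κ.real {t}) ≤ κ {t'}}) (fun t' => κ.real {t'})
    (hfin.subset Set.inter_subset_right) ⟨t, htA, by simp⟩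
  have hsub : {t' | κ.real {m} < κ.real {t'}} ⊆ A := by
    intro t' (ht' : κ.real {m} < κ.real {t'})
    by_contra htA'
    have h1 : κ.real {t} ≤ κ.real {m} := hmax t ⟨htA, by simp⟩
    refine absurd (hmax t' ⟨htA', ?_⟩) (not_le.2 ht')
    show ENNReal.ofReal (κ.real {t}) ≤ κ {t'}
    rw [← ofReal_measureReal (s := {t'})]
    exact ENNReal.ofReal_le_ofReal (h1.trans ht'.le)
  have h2 := measureReal_mono (μ := κ) hsub
  have h3 : α < κ.real {t' | κ.real {m} < κ.real {t'}} := not_le.1 hmA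
  linarith

/-- The coverage of the level sets, for an estimate `F θ D` with an independent parameter `θ`. -/
lemma le_measure_nuclear_of_indepFun {Ω Θ E : Type*} [MeasurableSpace Ω] [MeasurableSpace Θ]
    [MeasurableSpace E] {P : Measure Ω} [IsProbabilityMeasure P] {θ : Ω → Θ} {D : Ω → E}
    (hθ : Measurable θ) (hD : Measurable D) (hind : IndepFun θ D P) {F : Θ → E → ℕ}
    (hF : Measurable (Function.uncurry F)) {α : ℝ} (hα : α < 1) :
    α ≤ P.real {ω | (P.map fun ω' => F (θ ω) (D ω')).real
      {t | (P.map fun ω' => F (θ ω) (D ω')).real {F (θ ω) (D ω)} <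
        (P.map fun ω' => F (θ ω) (D ω')).real {t}} ≤ α} := by
  set ν := P.map D with hν
  have hνp : IsProbabilityMeasure ν := Measure.isProbabilityMeasure_map hD.aemeasurable
  have hFθ : ∀ x, Measurable (F x) := fun x => hF.comp measurable_prodMk_left
  have hmap : ∀ x, P.map (fun ω' => F x (D ω')) = ν.map (F x) := fun x =>
    (Measure.map_map (hFθ x) hD).symm
  have hκ : ∀ x, IsProbabilityMeasure (ν.map (F x)) := fun x =>
    Measure.isProbabilityMeasure_map (hFθ x).aemeasurable
  simp only [hmap]
  have hq : Measurable fun z : Θ × ℕ => (ν.map (F z.1)).real {z.2} := by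
    have h1 : MeasurableSet {w : (Θ × ℕ) × E | F w.1.1 w.2 = w.1.2} :=
      measurableSet_eq_fun
        (hF.comp (f := fun w : (Θ × ℕ) × E => (w.1.1, w.2)) (by fun_prop)) (by fun_prop)
    have h2 : Measurable fun z => ν.real (Prod.mk z ⁻¹' _) :=
      (measurable_measure_prodMk_left (ν := ν) h1).ennreal_toReal
    convert h2 using 2 with z
    rw [map_measureReal_apply (hFθ z.1) MeasurableSet.of_discrete]
    rfl
  have hT : Measurable fun z : Θ × ℕ => (ν.map (F z.1)).real
      {t | (ν.map (F z.1)).real {z.2} < (ν.map (F z.1)).real {t}} := by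
    have h1 : MeasurableSet {w : (Θ × ℕ) × E | (ν.map (F w.1.1)).real {w.1.2} <
        (ν.map (F w.1.1)).real {F w.1.1 w.2}} := by
      refine measurableSet_lt (hq.comp measurable_fst) ?_
      have h3 : Measurable fun w : (Θ × ℕ) × E => (w.1.1, F w.1.1 w.2) :=
        Measurable.prodMk (by fun_prop)
          (hF.comp (f := fun w : (Θ × ℕ) × E => (w.1.1, w.2)) (by fun_prop))
      exact hq.comp h3
    have h2 : Measurable fun z => ν.real (Prod.mk z ⁻¹' _) :=
      (measurable_measure_prodMk_left (ν := ν) h1).ennreal_toReal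
    convert h2 using 2 with z
    rw [map_measureReal_apply (hFθ z.1) MeasurableSet.of_discrete]
    rfl
  set S : Set (Θ × E) := {w | (ν.map (F w.1)).real
      {t | (ν.map (F w.1)).real {F w.1 w.2} < (ν.map (F w.1)).real {t}} ≤ α} with hS
  have hSm : MeasurableSet S := by
    have h3 : Measurable fun w : Θ × E => (w.1, F w.1 w.2) := Measurable.prodMk measurable_fst hF
    exact measurableSet_le (hT.comp h3) measurable_const
  -- Independence makes the joint law a product, so the level-set inequality applies with the
  -- parameter frozen and is then integrated.
  have hlaw : P.map (fun ω => (θ ω, D ω)) = (P.map θ).prod ν :=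
    (indepFun_iff_map_prod_eq_prod_map_map hθ.aemeasurable hD.aemeasurable).1 hind
  have hθp : IsProbabilityMeasure (P.map θ) := Measure.isProbabilityMeasure_map hθ.aemeasurable
  have hge : ENNReal.ofReal α ≤ P ((fun ω => (θ ω, D ω)) ⁻¹' S) := by
    rw [← Measure.map_apply (hθ.prodMk hD) hSm, hlaw, Measure.prod_apply hSm]
    calc ENNReal.ofReal α = ∫⁻ _x, ENNReal.ofReal α ∂(P.map θ) := by simp
      _ ≤ _ := lintegral_mono fun x => ?_
    have h1 := le_measure_level_set (ν.map (F x)) hα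
    rw [map_measureReal_apply (hFθ x) MeasurableSet.of_discrete] at h1
    have h2 := ENNReal.ofReal_le_ofReal h1
    rwa [ofReal_measureReal] at h2
  exact (ENNReal.ofReal_le_iff_le_toReal (measure_ne_top _ _)).1 hge

lemma nuclear_eq {n τ : ℕ} {tauHat : (Fin n → ℝ) → ℕ} (hT : Measurable tauHat)
    (M : Membership n τ) (y : Fin n → ℝ) :
    nuclear tauHat M y = ((stdNormal n).map fun u => tauHat (M.repro y u)).real
      {t | ((stdNormal n).map fun u => tauHat (M.repro y u)).real {tauHat y} <
        ((stdNormal n).map fun u => tauHat (M.repro y u)).real {t}} := by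
  have hm : Measurable fun u => tauHat (M.repro y u) := by
    refine hT.comp ?_
    have := M.measurable_direction
    unfold Membership.repro Membership.sample
    fun_prop
  set κ := (stdNormal n).map fun u => tauHat (M.repro y u) with hκ
  have hκp : IsProbabilityMeasure κ := Measure.isProbabilityMeasure_map hm.aemeasurable
  have hp : ∀ t, reproProb tauHat M y t = κ.real {t} := by
    intro t
    rw [hκ, map_measureReal_apply hm MeasurableSet.of_discrete]
    rfl
  have hp' : reproProb tauHat M y = fun t => κ.real {t} := funext hp
  rw [nuclear, hp']
  set S := {t | κ.real {tauHat y} < κ.real {t}} with hS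
  rw [Measure.real, ← Measure.tsum_indicator_apply_singleton κ S MeasurableSet.of_discrete,
    ENNReal.tsum_toReal_eq]
  · refine tsum_congr fun t => ?_
    by_cases ht : t ∈ S
    · rw [Set.indicator_of_mem ht, Set.indicator_of_mem ht]; rfl
    · rw [Set.indicator_of_notMem ht, Set.indicator_of_notMem ht]; rfl
  · intro t
    refine ne_top_of_le_ne_top (measure_ne_top κ {t}) ?_
    exact Set.indicator_le_self' (fun _ _ => zero_le) t

/-- The parameter is the pair of means and scales, the independent part is the direction, and
`repro_self` identifies the observed estimate. -/
lemma le_measure_nuclear_le {n τ : ℕ} {tauHat : (Fin n → ℝ) → ℕ} (hT : Measurable tauHat)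
    (M : Membership n τ) (μ σ : Fin τ → ℝ) (hσ : ∀ k, 0 < σ k) {α : ℝ} (hα : α < 1) :
    α ≤ (stdNormal n).real {U | nuclear tauHat M (M.sample μ σ U) ≤ α} := by
  have hsm : Measurable (M.sample μ σ) := by unfold Membership.sample; fun_prop
  have hF : Measurable (Function.uncurry fun (x : (Fin τ → ℝ) × (Fin τ → ℝ)) (d : Fin n → ℝ) =>
      tauHat (M.sample x.1 x.2 d)) := by
    refine hT.comp ?_
    unfold Membership.sample
    fun_prop
  have h := le_measure_nuclear_of_indepFun
    ((M.measurable_mean.comp hsm).prodMk (M.measurable_scale.comp hsm)) M.measurable_direction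
    (M.indepFun_mean_scale_direction μ σ hσ) hF hα
  refine h.trans (le_of_eq ?_)
  congr 1
  ext U
  simp only [Set.mem_ofPred_eq, nuclear_eq hT]
  have e : tauHat (M.sample μ σ U) = tauHat (M.sample (M.mean (M.sample μ σ U))
      (M.scale (M.sample μ σ U)) (M.direction U)) :=
    congrArg tauHat (M.repro_self μ σ hσ U).symm
  rw [e]
  exact Iff.rfl

/-! ### The BIC-based estimator -/

instance (n τ : ℕ) : Finite (Membership n τ) :=
  Finite.of_injective Membership.label fun M M' h => by
    cases M; cases M'; simpa using h

lemma measurable_bic {n τ : ℕ} (M : Membership n τ) : Measurable (bic M) := by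
  have := M.measurable_scale
  unfold bic
  fun_prop

lemma measurable_sInf_nat {Ω : Type*} [MeasurableSpace Ω] {Z : ℕ → Set Ω}
    (hZ : ∀ t, MeasurableSet (Z t)) : Measurable fun ω => sInf {t | ω ∈ Z t} := by
  refine measurable_to_countable' fun t => ?_
  -- The second piece accounts for `sInf ∅ = 0`.
  have h : (fun ω => sInf {t | ω ∈ Z t}) ⁻¹' {t} =
      (Z t \ ⋃ s ∈ Set.Iio t, Z s) ∪ ({_ω | t = 0} \ ⋃ s, Z s) := by
    ext ω
    simp only [Set.mem_preimage, Set.mem_singleton_iff, Set.mem_union, Set.mem_sdiff,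
      Set.mem_iUnion, Set.mem_Iio, not_exists, Set.mem_ofPred_eq]
    constructor
    · rintro rfl
      by_cases hne : {t | ω ∈ Z t}.Nonempty
      · exact Or.inl ⟨Nat.sInf_mem hne, fun s hs => Nat.notMem_of_lt_sInf hs⟩
      · rw [Set.not_nonempty_iff_eq_empty] at hne
        exact Or.inr ⟨by simp [hne], fun s hs => (Set.ext_iff.1 hne s).1 hs⟩
    · rintro (⟨h1, h2⟩ | ⟨h1, h2⟩)
      · refine le_antisymm (Nat.sInf_le h1) ?_
        by_contra! hlt
        exact h2 _ hlt (Nat.sInf_mem (s := {t | ω ∈ Z t}) ⟨t, h1⟩)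
      · have : {t | ω ∈ Z t} = ∅ := Set.eq_empty_of_forall_notMem h2
        rw [this, h1, Nat.sInf_empty]
  rw [h]
  exact ((hZ t).diff (MeasurableSet.biUnion (Set.to_countable _) fun s _ => hZ s)).union
    ((MeasurableSet.const _).diff (MeasurableSet.iUnion hZ))

lemma measurable_bicEstimator {n : ℕ} : Measurable (bicEstimator (n := n)) := by
  refine measurable_sInf_nat (Z := fun τ => {y | ∃ M : Membership n τ, (∀ k, 2 ≤ M.size k) ∧
    ∀ (τ' : ℕ) (M' : Membership n τ'), (∀ k, 2 ≤ M'.size k) → bic M y ≤ bic M' y}) fun τ => ?_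
  simp only [Set.ofPred_exists, Set.ofPred_and, Set.ofPred_forall]
  refine MeasurableSet.iUnion fun M =>
    (MeasurableSet.iInter fun _ => MeasurableSet.const _).inter ?_
  refine MeasurableSet.iInter fun τ' => MeasurableSet.iInter fun M' =>
    MeasurableSet.iInter fun _ => ?_
  exact measurableSet_le (measurable_bic M) (measurable_bic M')

end GaussMix

/-! ### Choice of `γ` and conclusion -/

open GaussMix
theorem theorem6 {n τ₀ : ℕ} (hn : τ₀ + 4 < n)
    (M₀ : Membership n τ₀) (hM₀ : ∀ k, 2 ≤ M₀.size k)
    (μ₀ σ₀ : Fin τ₀ → ℝ) (hσ₀ : ∀ k, 0 < σ₀ k)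
    (hC : 1 < τ₀ → 0 < cMin M₀ μ₀)
    (δ : ℝ) (hδ : 0 < δ) :
    ∃ γ : ℝ, 0 < γ ∧ ∃ c : ℝ, 0 < c ∧
      (1 < τ₀ → lamLower n γ < lamUpper M₀ μ₀ σ₀ γ) ∧
      ∀ lam ∈ lamRange M₀ μ₀ σ₀ γ,
        AtLeastUpToExp c (1 - δ) (candidateProb M₀ μ₀ σ₀ lam) ∧
        ∀ α : ℝ, 0 < α → α < 1 →
          AtLeastUpToExp c (α - δ) (coverageProb bicEstimator M₀ μ₀ σ₀ lam α) ∧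
          ∀ tauHat : (Fin n → ℝ) → ℕ, Measurable tauHat →
            AtLeastUpToExp c (α - δ) (coverageProb tauHat M₀ μ₀ σ₀ lam α) := by
  have hn1 : 1 < n := by omega
  set g : ℕ → ℝ := fun m => 1 / ((m : ℝ) + 1) with hg
  have hgpos : ∀ m, 0 < g m := fun m => by positivity
  have hglim : Tendsto g atTop (𝓝 0) := tendsto_one_div_add_atTop_nhds_zero_nat
  have hglim' : Tendsto g atTop (𝓝[>] 0) :=
    tendsto_nhdsWithin_iff.2 ⟨hglim, Eventually.of_forall hgpos⟩
  have h1 := (tendsto_measure_closeNoise_diag M₀ μ₀ σ₀ (injective_of_cMin_pos M₀ μ₀ hC) hgpos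
    hglim).eventually (lt_mem_nhds (by linarith : 1 - δ < 1))
  have h2 : ∀ᶠ m in atTop, 1 < τ₀ → lamLower n (g m) < lamUpper M₀ μ₀ σ₀ (g m) := by
    rw [eventually_imp_distrib_left]
    exact fun hτ => hglim'.eventually
      (eventually_lamLower_lt_lamUpper hn1 M₀ μ₀ σ₀ hσ₀ hτ (hC hτ))
  obtain ⟨m, hm1, hm2⟩ := (h1.and h2).exists
  have hopen := isOpen_closeNoise M₀ μ₀ σ₀ (g m)
  have hpos : 1 - δ < (stdNormal n).real
      {U | 0 < stdNormal n {u | (U, u) ∈ closeNoise M₀ μ₀ σ₀ (g m)}} := by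
    refine hm1.trans_le (measureReal_mono fun U hU => ?_)
    exact (hopen.preimage (Continuous.prodMk_right U)).measure_pos _ ⟨U, hU⟩
  obtain ⟨c, hc, ε, hε, hsearch⟩ := exists_isLittleOpExp_search hopen.measurableSet hpos
  have hcand : ∀ lam ∈ lamRange M₀ μ₀ σ₀ (g m), ∀ N (V : Fin N → Fin n → ℝ) (U : Fin n → ℝ),
      (∃ s, (U, V s) ∈ closeNoise M₀ μ₀ σ₀ (g m)) →
        (⟨τ₀, M₀⟩ : Σ τ : ℕ, Membership n τ) ∈ candidateSet lam V (M₀.sample μ₀ σ₀ U) := by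
    rintro lam hlam N V U ⟨s, hs⟩
    exact ⟨s, fun q => modifiedBIC_le_of_closeNoise hn1 M₀ hM₀ μ₀ σ₀ hσ₀ (hgpos m) hs hlam q.2⟩
  refine ⟨g m, hgpos m, c, hc, hm2, fun lam hlam => ⟨⟨ε, hε, fun N V => ?_⟩, fun α _ hα => ?_⟩⟩
  · exact (hsearch N V).trans (measureReal_mono fun U hU => hcand lam hlam N V U hU)
  have hcov : ∀ tauHat : (Fin n → ℝ) → ℕ, Measurable tauHat →
      AtLeastUpToExp c (α - δ) (coverageProb tauHat M₀ μ₀ σ₀ lam α) := by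
    intro tauHat hT
    refine ⟨ε, hε, fun N V => ?_⟩
    set A := {U | ∃ s, (U, V s) ∈ closeNoise M₀ μ₀ σ₀ (g m)} with hA
    set B := {U | nuclear tauHat M₀ (M₀.sample μ₀ σ₀ U) ≤ α} with hB
    have hAm : MeasurableSet A := by
      rw [hA, Set.ofPred_exists]
      exact MeasurableSet.iUnion fun s =>
        (measurable_id.prodMk measurable_const) hopen.measurableSet
    have hAB : A ∩ B ⊆ {U | τ₀ ∈ confidenceSet tauHat lam α V (M₀.sample μ₀ σ₀ U)} :=
      fun U hU => ⟨M₀, hcand lam hlam N V U hU.1, hU.2⟩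
    have e1 := hsearch N V
    have e2 := le_measure_nuclear_le hT M₀ μ₀ σ₀ hσ₀ hα
    -- Search success and nuclear coverage need not be independent; the union bound costs only the
    -- failure probability of the search.
    have e3 : (stdNormal n).real B ≤ (stdNormal n).real (A ∩ B) + (stdNormal n).real Aᶜ := by
      refine (measureReal_mono fun U hU => ?_).trans (measureReal_union_le (A ∩ B) Aᶜ)
      by_cases hUA : U ∈ A
      · exact Or.inl ⟨hUA, hU⟩
      · exact Or.inr hUA
    rw [probReal_compl_eq_one_sub hAm] at e3
    have e4 := measureReal_mono (μ := stdNormal n) hAB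
    unfold coverageProb
    linarith
  exact ⟨hcov _ measurable_bicEstimator, hcov⟩
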